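/- Let $d\ge 2$ and let $\Omega\subset\mathbb R^d$ be a bounded Lipschitz domain, i.e. a bounded open set that near every boundary point lies below the graph of a Lipschitz function (in a suitable orthonormal coordinate system), with boundary $\Gamma=\partial\Omega$ and exterior unit normal $\mathbf n$. Let $H^1(\Omega)$ and $H(\mathrm{div},\Omega)$ be the spaces of real-valued functions, respectively vector fields, in $L^2(\Omega)$ whose weak gradient, respectively weak divergence, lies in $L^2(\Omega)$. Let $\varphi\mapsto\varphi|_\Gamma$ be the trace operator $H^1(\Omega)\to L^2(\Gamma)$, let $H^{1/2}(\Gamma)=\{\varphi|_\Gamma:\varphi\in H^1(\Omega)\}$, and let the normal trace $\mathbf n\cdot\boldsymbol\sigma|_\Gamma$ of $\boldsymbol\sigma\in H(\mathrm{div},\Omega)$ be the functional on $H^{1/2}(\Gamma)$ given by $$\langle\varphi|_\Gamma,\mathbf n\cdot\boldsymbol\sigma|_\Gamma\rangle_\Gamma=(\nabla\varphi,\boldsymbol\sigma)_{L^2(\Omega)}+(\varphi,\operatorname{div}\boldsymbol\sigma)_{L^2(\Omega)}\qquad(\varphi\in H^1(\Omega)).$$ Let $g\in H^{1/2}(\Gamma)$,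 and let $v\in H^1(\Omega)$ satisfy $\Delta v=0$ weakly in $\Omega$. Then the following hold. 1. There is a unique $u\in H^1(\Omega)$ with $\Delta u=0$ weakly in $\Omega$ and $u|_\Gamma=g$. 2. There is a unique pair $(\boldsymbol\tau,\omega)\in H(\mathrm{div},\Omega)\times L^2(\Omega)$ such that $$(\boldsymbol\tau,\boldsymbol\sigma)_{L^2(\Omega)}+(\operatorname{div}\boldsymbol\sigma,\omega)_{L^2(\Omega)}=\langle g-v|_\Gamma,\mathbf n\cdot\boldsymbol\sigma|_\Gamma\rangle_\Gamma,\qquad(\operatorname{div}\boldsymbol\tau,\psi)_{L^2(\Omega)}=0$$ for all $(\boldsymbol\sigma,\psi)\in H(\mathrm{div},\Omega)\times L^2(\Omega)$. 3. This pair is $(\boldsymbol\tau,\omega)=(\nabla(u-v),\,u-v)$. Moreover, $\boldsymbol\tau$ is the unique maximiser of $2\langle g-v|_\Gamma,\mathbf n\cdot\boldsymbol\sigma|_\Gamma\rangle_\Gamma-\|\boldsymbol\sigma\|_{L^2(\Omega)}^2$ over all $\boldsymbol\sigma\in L^2(\Omega)$ with $\operatorname{div}\boldsymbol\sigma=0$,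 and $\omega=u-v$ is the unique minimiser of $\|\nabla w\|_{L^2(\Omega)}^2$ over all $w\in H^1(\Omega)$ with $w|_\Gamma=g-v|_\Gamma$. -/

import Mathlib

noncomputable section

namespace FunctionalBEM

open MeasureTheory Topology Set
open scoped Gradient

/-- Euclidean space `ℝ^d`. -/
abbrev Space (d : ℕ) : Type := EuclideanSpace ℝ (Fin d)

/-- Bounded Lipschitz domains: bounded open sets that near every boundary point lie strictly
below the graph of a Lipschitz function, in some orthonormal coordinate system. Here `e` is the
direction of the last coordinate axis, and the hyperplane orthogonal to `e` carries the other
coordinates. -/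
structure IsBoundedLipschitzDomain {d : ℕ} (Ω : Set (Space d)) : Prop where
  isOpen : IsOpen Ω
  isBounded : Bornology.IsBounded Ω
  locally_subgraph : ∀ x ∈ frontier Ω, ∃ e : Space d, ‖e‖ = 1 ∧
    ∃ (K : NNReal) (h : (Submodule.span ℝ {e})ᗮ → ℝ), LipschitzWith K h ∧
      ∃ r > 0, ∀ y ∈ Metric.ball x r,
        y ∈ Ω ↔ inner ℝ e y < h ((Submodule.span ℝ {e})ᗮ.orthogonalProjectionOnto y)

/-- The surface measure on `Γ = ∂Ω`: the normalised `(d - 1)`-dimensional Hausdorff measure. -/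
def surface {d : ℕ} (Ω : Set (Space d)) : Measure (Space d) :=
  (Measure.euclideanHausdorffMeasure (d - 1)).restrict (frontier Ω)

/-- Real-valued functions in `L²(Ω)`. -/
abbrev L2 {d : ℕ} (Ω : Set (Space d)) : Type := Lp ℝ 2 (volume.restrict Ω)

/-- Vector fields in `L²(Ω)`. -/
abbrev L2Vec {d : ℕ} (Ω : Set (Space d)) : Type := Lp (Space d) 2 (volume.restrict Ω)

/-- Real-valued functions in `L²(Γ)`. -/
abbrev L2Bdry {d : ℕ} (Ω : Set (Space d)) : Type := Lp ℝ 2 (surface Ω)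

/-- Test functions in `C_c^∞(Ω)`. -/
structure IsTestFunction {d : ℕ} (Ω : Set (Space d)) (η : Space d → ℝ) : Prop where
  smooth : ContDiff ℝ (⊤ : ℕ∞) η
  hasCompactSupport : HasCompactSupport η
  tsupport_subset : tsupport η ⊆ Ω

/-- `G` is the weak gradient of `φ` in `Ω`. -/
def IsWeakGradient {d : ℕ} (Ω : Set (Space d)) (φ : L2 Ω) (G : L2Vec Ω) : Prop :=
  ∀ η : Space d → ℝ, IsTestFunction Ω η →
    ∫ x in Ω, φ x • ∇ η x = -∫ x in Ω, η x • G x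

/-- `f` is the weak divergence of `σ` in `Ω`. -/
def IsWeakDivergence {d : ℕ} (Ω : Set (Space d)) (σ : L2Vec Ω) (f : L2 Ω) : Prop :=
  ∀ η : Space d → ℝ, IsTestFunction Ω η →
    ∫ x in Ω, inner ℝ (σ x) (∇ η x) = -∫ x in Ω, η x * f x

section TestFunction

variable {d : ℕ} {Ω : Set (Space d)} {η : Space d → ℝ}

theorem IsTestFunction.continuous_gradient (hη : IsTestFunction Ω η) :
    Continuous (fun x => ∇ η x) :=
  (InnerProductSpace.toDual ℝ (Space d)).symm.continuous.comp
    (hη.smooth.continuous_fderiv (by simp))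

theorem IsTestFunction.memLp (hη : IsTestFunction Ω η) (p : ENNReal) :
    MemLp η p (volume.restrict Ω) :=
  (hη.smooth.continuous.memLp_of_hasCompactSupport hη.hasCompactSupport).restrict Ω

theorem IsTestFunction.memLp_gradient (hη : IsTestFunction Ω η) (p : ENNReal) :
    MemLp (fun x => ∇ η x) p (volume.restrict Ω) := by
  refine (hη.continuous_gradient.memLp_of_hasCompactSupport ?_).restrict Ω
  exact (hη.hasCompactSupport.fderiv (𝕜 := ℝ)).comp_left
    (g := (InnerProductSpace.toDual ℝ (Space d)).symm) (map_zero _)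

theorem IsTestFunction.integrable_smul_gradient (hη : IsTestFunction Ω η) (φ : L2 Ω) :
    Integrable (fun x => φ x • ∇ η x) (volume.restrict Ω) :=
  memLp_one_iff_integrable.1 ((hη.memLp_gradient 2).smul (Lp.memLp φ))

theorem IsTestFunction.integrable_smul (hη : IsTestFunction Ω η) (G : L2Vec Ω) :
    Integrable (fun x => η x • G x) (volume.restrict Ω) :=
  memLp_one_iff_integrable.1 ((Lp.memLp G).smul (hη.memLp 2))

theorem IsTestFunction.integrable_mul (hη : IsTestFunction Ω η) (f : L2 Ω) :
    Integrable (fun x => η x * f x) (volume.restrict Ω) :=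
  (hη.memLp 2).integrable_mul (Lp.memLp f)

theorem IsTestFunction.integrable_inner_gradient (hη : IsTestFunction Ω η) (σ : L2Vec Ω) :
    Integrable (fun x => inner ℝ (σ x) (∇ η x)) (volume.restrict Ω) :=
  memLp_one_iff_integrable.1 <| MemLp.of_bilin (p := 2) (q := 2) (r := 1)
    (fun a b : Space d => inner ℝ a b) 1 (Lp.memLp σ) (hη.memLp_gradient 2)
    ((Lp.memLp σ).1.inner (hη.memLp_gradient 2).1)
    (Filter.Eventually.of_forall fun x => by
      simpa using nnnorm_inner_le_nnnorm (𝕜 := ℝ) (σ x) (∇ η x))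

end TestFunction

/-- The Sobolev space `H¹(Ω)`: functions `φ ∈ L²(Ω)` that possess a weak gradient in `L²(Ω)`.
An element is stored together with its weak gradient, as the pair `(φ, ∇φ)`; for open `Ω` the
second entry is determined by the first. -/
def H1 {d : ℕ} (Ω : Set (Space d)) : Submodule ℝ (L2 Ω × L2Vec Ω) where
  carrier := {p | IsWeakGradient Ω p.1 p.2}
  zero_mem' := by
    intro η _
    have h1 : (fun x => ((0 : L2 Ω) : Space d → ℝ) x • ∇ η x) =ᵐ[volume.restrict Ω] 0 := by
      filter_upwards [Lp.coeFn_zero ℝ 2 (volume.restrict Ω)] with x hx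
      simp only [hx, Pi.zero_apply, zero_smul]
    have h2 : (fun x => η x • ((0 : L2Vec Ω) : Space d → Space d) x)
        =ᵐ[volume.restrict Ω] 0 := by
      filter_upwards [Lp.coeFn_zero (Space d) 2 (volume.restrict Ω)] with x hx
      simp only [hx, Pi.zero_apply, smul_zero]
    simp only [Prod.fst_zero, Prod.snd_zero]
    rw [integral_congr_ae h1, integral_congr_ae h2]
    simp
  add_mem' := by
    intro p q hp hq η hη
    have h1 : (fun x => (p.1 + q.1 : L2 Ω) x • ∇ η x) =ᵐ[volume.restrict Ω]
        fun x => p.1 x • ∇ η x + q.1 x • ∇ η x := by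
      filter_upwards [Lp.coeFn_add p.1 q.1] with x hx
      simp only [hx, Pi.add_apply, add_smul]
    have h2 : (fun x => η x • (p.2 + q.2 : L2Vec Ω) x) =ᵐ[volume.restrict Ω]
        fun x => η x • p.2 x + η x • q.2 x := by
      filter_upwards [Lp.coeFn_add p.2 q.2] with x hx
      simp only [hx, Pi.add_apply, smul_add]
    simp only [Prod.fst_add, Prod.snd_add]
    rw [integral_congr_ae h1, integral_congr_ae h2,
      integral_add (hη.integrable_smul_gradient _) (hη.integrable_smul_gradient _),
      integral_add (hη.integrable_smul _) (hη.integrable_smul _), hp η hη, hq η hη, neg_add]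
  smul_mem' := by
    intro c p hp η hη
    have h1 : (fun x => (c • p.1 : L2 Ω) x • ∇ η x) =ᵐ[volume.restrict Ω]
        fun x => c • (p.1 x • ∇ η x) := by
      filter_upwards [Lp.coeFn_smul c p.1] with x hx
      simp [hx, smul_smul]
    have h2 : (fun x => η x • (c • p.2 : L2Vec Ω) x) =ᵐ[volume.restrict Ω]
        fun x => c • (η x • p.2 x) := by
      filter_upwards [Lp.coeFn_smul c p.2] with x hx
      simp [hx, smul_smul, mul_comm]
    simp only [Prod.smul_fst, Prod.smul_snd]
    rw [integral_congr_ae h1, integral_congr_ae h2, integral_smul, integral_smul, hp η hη,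
      smul_neg]

/-- The space `H(div, Ω)`: vector fields `σ ∈ L²(Ω)` that possess a weak divergence in `L²(Ω)`.
An element is stored together with its weak divergence, as the pair `(σ, div σ)`; for open `Ω`
the second entry is determined by the first. -/
def HDiv {d : ℕ} (Ω : Set (Space d)) : Submodule ℝ (L2Vec Ω × L2 Ω) where
  carrier := {p | IsWeakDivergence Ω p.1 p.2}
  zero_mem' := by
    intro η _
    have h1 : (fun x => inner ℝ (((0 : L2Vec Ω) : Space d → Space d) x) (∇ η x))
        =ᵐ[volume.restrict Ω] 0 := by
      filter_upwards [Lp.coeFn_zero (Space d) 2 (volume.restrict Ω)] with x hx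
      simp only [hx, Pi.zero_apply, inner_zero_left]
    have h2 : (fun x => η x * ((0 : L2 Ω) : Space d → ℝ) x) =ᵐ[volume.restrict Ω] 0 := by
      filter_upwards [Lp.coeFn_zero ℝ 2 (volume.restrict Ω)] with x hx
      simp only [hx, Pi.zero_apply, mul_zero]
    simp only [Prod.fst_zero, Prod.snd_zero]
    rw [integral_congr_ae h1, integral_congr_ae h2]
    simp
  add_mem' := by
    intro p q hp hq η hη
    have h1 : (fun x => inner ℝ ((p.1 + q.1 : L2Vec Ω) x) (∇ η x)) =ᵐ[volume.restrict Ω]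
        fun x => inner ℝ (p.1 x) (∇ η x) + inner ℝ (q.1 x) (∇ η x) := by
      filter_upwards [Lp.coeFn_add p.1 q.1] with x hx
      simp only [hx, Pi.add_apply, inner_add_left]
    have h2 : (fun x => η x * (p.2 + q.2 : L2 Ω) x) =ᵐ[volume.restrict Ω]
        fun x => η x * p.2 x + η x * q.2 x := by
      filter_upwards [Lp.coeFn_add p.2 q.2] with x hx
      simp only [hx, Pi.add_apply, mul_add]
    simp only [Prod.fst_add, Prod.snd_add]
    rw [integral_congr_ae h1, integral_congr_ae h2,
      integral_add (hη.integrable_inner_gradient _) (hη.integrable_inner_gradient _),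
      integral_add (hη.integrable_mul _) (hη.integrable_mul _), hp η hη, hq η hη, neg_add]
  smul_mem' := by
    intro c p hp η hη
    have h1 : (fun x => inner ℝ ((c • p.1 : L2Vec Ω) x) (∇ η x)) =ᵐ[volume.restrict Ω]
        fun x => c * inner ℝ (p.1 x) (∇ η x) := by
      filter_upwards [Lp.coeFn_smul c p.1] with x hx
      simp only [hx, Pi.smul_apply, real_inner_smul_left]
    have h2 : (fun x => η x * (c • p.2 : L2 Ω) x) =ᵐ[volume.restrict Ω]
        fun x => c * (η x * p.2 x) := by
      filter_upwards [Lp.coeFn_smul c p.2] with x hx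
      simp [hx, mul_left_comm]
    simp only [Prod.smul_fst, Prod.smul_snd]
    rw [integral_congr_ae h1, integral_congr_ae h2, integral_const_mul, integral_const_mul,
      hp η hη, mul_neg]

/-- The function `φ ∈ L²(Ω)` underlying an element of `H¹(Ω)`. -/
def fn {d : ℕ} {Ω : Set (Space d)} (φ : H1 Ω) : L2 Ω := φ.1.1

/-- The weak gradient `∇φ ∈ L²(Ω)` of `φ ∈ H¹(Ω)`. -/
def grad {d : ℕ} {Ω : Set (Space d)} (φ : H1 Ω) : L2Vec Ω := φ.1.2

/-- The vector field `σ ∈ L²(Ω)` underlying an element of `H(div, Ω)`. -/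
def field {d : ℕ} {Ω : Set (Space d)} (σ : HDiv Ω) : L2Vec Ω := σ.1.1

/-- The weak divergence `div σ ∈ L²(Ω)` of `σ ∈ H(div, Ω)`. -/
def div {d : ℕ} {Ω : Set (Space d)} (σ : HDiv Ω) : L2 Ω := σ.1.2

/-- `Δφ = 0` in `Ω`, weakly: `∇φ` has the weak divergence `0`. -/
def IsHarmonic {d : ℕ} {Ω : Set (Space d)} (φ : H1 Ω) : Prop :=
  IsWeakDivergence Ω (grad φ) 0

/-- The triples `(η|_Ω, ∇η|_Ω, η|_Γ)` for `η ∈ C^∞(ℝ^d)`. -/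
def smoothTraceGraph {d : ℕ} (Ω : Set (Space d)) :
    Submodule ℝ (L2 Ω × L2Vec Ω × L2Bdry Ω) where
  carrier := {p | ∃ η : Space d → ℝ, ContDiff ℝ (⊤ : ℕ∞) η ∧ p.1 =ᵐ[volume.restrict Ω] η ∧
    p.2.1 =ᵐ[volume.restrict Ω] (fun x => ∇ η x) ∧ p.2.2 =ᵐ[surface Ω] η}
  zero_mem' := by
    refine ⟨fun _ => 0, contDiff_const, Lp.coeFn_zero _ _ _, ?_, Lp.coeFn_zero _ _ _⟩
    filter_upwards [Lp.coeFn_zero (Space d) 2 (volume.restrict Ω)] with x hx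
    simpa [gradient_fun_const] using hx
  add_mem' := by
    rintro p q ⟨η, hη, h1, h2, h3⟩ ⟨ζ, hζ, k1, k2, k3⟩
    refine ⟨η + ζ, hη.add hζ, ?_, ?_, ?_⟩
    · filter_upwards [Lp.coeFn_add p.1 q.1, h1, k1] with x hx hx1 hx2
      simp only [Prod.fst_add, hx, Pi.add_apply, hx1, hx2]
    · filter_upwards [Lp.coeFn_add p.2.1 q.2.1, h2, k2] with x hx hx1 hx2
      have hd1 : DifferentiableAt ℝ η x := (hη.differentiable (by simp)).differentiableAt
      have hd2 : DifferentiableAt ℝ ζ x := (hζ.differentiable (by simp)).differentiableAt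
      simp only [Prod.snd_add, Prod.fst_add, hx, Pi.add_apply, hx1, hx2]
      simp [gradient, fderiv_add hd1 hd2]
    · filter_upwards [Lp.coeFn_add p.2.2 q.2.2, h3, k3] with x hx hx1 hx2
      simp only [Prod.snd_add, hx, Pi.add_apply, hx1, hx2]
  smul_mem' := by
    rintro c p ⟨η, hη, h1, h2, h3⟩
    refine ⟨c • η, contDiff_const.smul hη, ?_, ?_, ?_⟩
    · filter_upwards [Lp.coeFn_smul c p.1, h1] with x hx hx1
      simp [hx, hx1]
    · filter_upwards [Lp.coeFn_smul c p.2.1, h2] with x hx hx1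
      have hd1 : DifferentiableAt ℝ η x := (hη.differentiable (by simp)).differentiableAt
      simp only [Prod.smul_snd, Prod.smul_fst, hx, Pi.smul_apply, hx1]
      simp [gradient, fderiv_const_smul hd1]
    · filter_upwards [Lp.coeFn_smul c p.2.2, h3] with x hx hx1
      simp [hx, hx1]

/-- `f ∈ L²(Γ)` is the trace of `φ ∈ H¹(Ω)`: there are `η_n ∈ C^∞(ℝ^d)` with `η_n → φ` in `H¹(Ω)`
and `η_n|_Γ → f` in `L²(Γ)`. In other words, the trace operator `H¹(Ω) → L²(Γ)` is the closure of
the restriction map `η|_Ω ↦ η|_Γ` on smooth functions. -/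
def HasTrace {d : ℕ} {Ω : Set (Space d)} (φ : H1 Ω) (f : L2Bdry Ω) : Prop :=
  (fn φ, grad φ, f) ∈ (smoothTraceGraph Ω).topologicalClosure

/-- The trace space `H^{1/2}(Γ) = {φ|_Γ : φ ∈ H¹(Ω)}`, a linear subspace of `L²(Γ)`. -/
def HHalf {d : ℕ} (Ω : Set (Space d)) : Submodule ℝ (L2Bdry Ω) where
  carrier := {f | ∃ φ : H1 Ω, HasTrace φ f}
  zero_mem' := ⟨0, (smoothTraceGraph Ω).topologicalClosure.zero_mem⟩
  add_mem' := by
    rintro f g ⟨φ, hφ⟩ ⟨ψ, hψ⟩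
    exact ⟨φ + ψ, (smoothTraceGraph Ω).topologicalClosure.add_mem hφ hψ⟩
  smul_mem' := by
    rintro c f ⟨φ, hφ⟩
    exact ⟨c • φ, (smoothTraceGraph Ω).topologicalClosure.smul_mem c hφ⟩

theorem mem_HHalf {d : ℕ} {Ω : Set (Space d)} {f : L2Bdry Ω} :
    f ∈ HHalf Ω ↔ ∃ φ : H1 Ω, HasTrace φ f := Iff.rfl

open Classical in
/-- The trace operator `H¹(Ω) → H^{1/2}(Γ)`, `φ ↦ φ|_Γ`. -/
def trace {d : ℕ} {Ω : Set (Space d)} (φ : H1 Ω) : HHalf Ω :=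
  if h : ∃ f : L2Bdry Ω, HasTrace φ f then
    ⟨Classical.choose h, mem_HHalf.2 ⟨φ, Classical.choose_spec h⟩⟩
  else 0

/-- Some `φ ∈ H¹(Ω)` with `φ|_Γ = ψ`. -/
def lift {d : ℕ} {Ω : Set (Space d)} (ψ : HHalf Ω) : H1 Ω :=
  Classical.choose (mem_HHalf.1 ψ.2)

/-- The normal trace `n·σ|_Γ` of `σ ∈ H(div, Ω)` as a functional on `H^{1/2}(Γ)`, given by the
Green formula `⟨φ|_Γ, n·σ|_Γ⟩ = (∇φ, σ)_{L²(Ω)} + (φ, div σ)_{L²(Ω)}` for `φ ∈ H¹(Ω)`. On a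
bounded Lipschitz domain the right-hand side depends on `φ|_Γ` only. -/
def normalTrace {d : ℕ} {Ω : Set (Space d)} (σ : HDiv Ω) (ψ : HHalf Ω) : ℝ :=
  inner ℝ (grad (lift ψ)) (field σ) + inner ℝ (fn (lift ψ)) (div σ)

/-- `u ∈ H¹(Ω)` solves the Dirichlet problem `Δu = 0` in `Ω`, `u = g` on `Γ`. -/
def IsDirichletSolution {d : ℕ} {Ω : Set (Space d)} (g : HHalf Ω) (u : H1 Ω) : Prop :=
  IsHarmonic u ∧ trace u = g

/-- `(τ, ω) ∈ H(div, Ω) × L²(Ω)` solves the mixed problem with boundary datum `f`: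
`(τ, σ) + (div σ, ω) = ⟨f, n·σ|_Γ⟩` and `(div τ, ψ) = 0` for all
`(σ, ψ) ∈ H(div, Ω) × L²(Ω)`. -/
def IsMixedSolution {d : ℕ} {Ω : Set (Space d)} (f : HHalf Ω) (τ : HDiv Ω) (ω : L2 Ω) : Prop :=
  ∀ (σ : HDiv Ω) (ψ : L2 Ω),
    inner ℝ (field τ) (field σ) + inner ℝ (div σ) ω = normalTrace σ f ∧
      inner ℝ (div τ) ψ = 0

/-- The minorant `2 ⟨f, n·τ|_Γ⟩ - ‖τ‖²`, with `f = g - v|_Γ`. -/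
def minorant {d : ℕ} {Ω : Set (Space d)} (f : HHalf Ω) (τ : HDiv Ω) : ℝ :=
  2 * normalTrace τ f - ‖field τ‖ ^ 2

/-- The majorant `‖∇w‖²`. -/
def majorant {d : ℕ} {Ω : Set (Space d)} (w : H1 Ω) : ℝ :=
  ‖grad w‖ ^ 2

/-- `a` is the unique maximiser of `F` over `S`. -/
def IsUniqueMaximiser {α : Type*} (F : α → ℝ) (S : Set α) (a : α) : Prop :=
  a ∈ S ∧ ∀ b ∈ S, b ≠ a → F b < F a

/-- `a` is the unique minimiser of `F` over `S`. -/
def IsUniqueMinimiser {α : Type*} (F : α → ℝ) (S : Set α) (a : α) : Prop :=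
  a ∈ S ∧ ∀ b ∈ S, b ≠ a → F a < F b

end FunctionalBEM

end

/-!
The trace operator is defined as the closure of restriction on smooth functions, so everything
rests on the density of smooth functions in `H¹(Ω)`. It is obtained by localising with a partition
of unity and shifting each piece in the direction of the local graph before mollifying: shifting
outwards approximates `φ ∈ H¹(Ω)` by smooth functions up to the boundary, shifting the extension
by zero inwards approximates it by test functions.

On the subgraph of a Lipschitz function, Fubini's theorem and the area formula bound boundary
integrals by integrals over `Ω` and conversely. Applied to `θ η²`, with `θ` a cutoff and `η`
smooth, this gives `‖η‖_{L²(Γ)} ≤ C ‖η‖_{H¹(Ω)}`, so that every `φ ∈ H¹(Ω)` has exactly one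
trace. The converse bound `|∫_Ω ∇w| ≤ C ‖w‖_{L¹(Γ)}`, applied to `w = η κ` with a test function `κ`
on `ℝ^d`, shows that a function of trace zero, extended by zero, is weakly differentiable on
`ℝ^d`; it is therefore in `H¹₀(Ω)`, the closure of the test functions.

By the Poincaré inequality the gradients of `H¹₀(Ω)` form a closed subspace of `L²(Ω)`, and
projecting the gradient of a lift of `g` onto its complement solves the Dirichlet problem. With
`w = u - v`, Green's formula turns the duality into two Pythagorean identities: for `div σ = 0` the
minorant is `‖∇w‖² - ‖∇w - σ‖²`, and for `w'|_Γ = w|_Γ` the majorant is `‖∇w‖² + ‖∇w' - ∇w‖²`.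
-/

namespace FunctionalBEM

open MeasureTheory Topology Set
open scoped Gradient

section Mollification

open scoped Convolution

theorem eLpNorm_two_sq {α E : Type*} [MeasurableSpace α] [NormedAddCommGroup E] (μ : Measure α)
    (f : α → E) : eLpNorm f 2 μ ^ 2 = ∫⁻ x, ‖f x‖ₑ ^ 2 ∂μ := by
  have h := eLpNorm_nnreal_pow_eq_lintegral (f := f) (p := 2) (μ := μ) two_ne_zero
  norm_cast at h
  simpa only [ENNReal.rpow_ofNat] using h

theorem enorm_integral_sq_le_lintegral {T E : Type*} [MeasurableSpace T] [NormedAddCommGroup E]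
    [NormedSpace ℝ E] {ν : Measure T} [IsProbabilityMeasure ν] {u : T → E}
    (hu : AEStronglyMeasurable u ν) : ‖∫ t, u t ∂ν‖ₑ ^ 2 ≤ ∫⁻ t, ‖u t‖ₑ ^ 2 ∂ν := by
  rw [← eLpNorm_two_sq]
  gcongr
  calc ‖∫ t, u t ∂ν‖ₑ ≤ eLpNorm u 1 ν := by
        rw [eLpNorm_one_eq_lintegral_enorm]
        exact enorm_integral_le_lintegral_enorm u
    _ ≤ eLpNorm u 2 ν := eLpNorm_le_eLpNorm_of_exponent_le (by norm_num) hu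

theorem eLpNorm_two_integral_le_of_ae_le {X T E : Type*} [MeasurableSpace X] [MeasurableSpace T]
    [NormedAddCommGroup E] [NormedSpace ℝ E] {μ : Measure X} [SFinite μ] {ν : Measure T}
    [IsProbabilityMeasure ν] {F : X → T → E}
    (hF : AEStronglyMeasurable (Function.uncurry F) (μ.prod ν)) {ε : ENNReal}
    (hε : ∀ᵐ t ∂ν, eLpNorm (fun x => F x t) 2 μ ≤ ε) :
    eLpNorm (fun x => ∫ t, F x t ∂ν) 2 μ ≤ ε := by
  rw [← ENNReal.pow_le_pow_left_iff two_ne_zero, eLpNorm_two_sq]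
  calc ∫⁻ x, ‖∫ t, F x t ∂ν‖ₑ ^ 2 ∂μ
      ≤ ∫⁻ x, ∫⁻ t, ‖F x t‖ₑ ^ 2 ∂ν ∂μ := by
        refine lintegral_mono_ae ?_
        filter_upwards [hF.prodMk_left] with x hx using enorm_integral_sq_le_lintegral hx
    _ = ∫⁻ t, eLpNorm (fun x => F x t) 2 μ ^ 2 ∂ν := by
        rw [lintegral_lintegral_swap (hF.enorm.pow_const 2)]
        simp only [eLpNorm_two_sq]
    _ ≤ ∫⁻ _, ε ^ 2 ∂ν := lintegral_mono_ae (hε.mono fun t ht => by gcongr)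
    _ = ε ^ 2 := by rw [lintegral_const, measure_univ, mul_one]

theorem isProbabilityMeasure_withDensity_ofReal {T : Type*} [MeasurableSpace T] {μ : Measure T}
    {ρ : T → ℝ} (hρ : ∀ x, 0 ≤ ρ x) (hρ1 : ∫ x, ρ x ∂μ = 1) :
    IsProbabilityMeasure (μ.withDensity fun x => ENNReal.ofReal (ρ x)) := by
  have hint : Integrable ρ μ := by
    by_contra h
    exact zero_ne_one ((integral_undef h).symm.trans hρ1)
  refine ⟨?_⟩
  rw [withDensity_apply _ MeasurableSet.univ, Measure.restrict_univ,
    ← ofReal_integral_eq_lintegral_ofReal hint (.of_forall hρ), hρ1, ENNReal.ofReal_one]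

variable {V E : Type*} [NormedAddCommGroup V] [NormedSpace ℝ V] [FiniteDimensional ℝ V]
  [MeasurableSpace V] [BorelSpace V] {μ : Measure V} [μ.IsAddHaarMeasure]
  [NormedAddCommGroup E]

theorem tendsto_eLpNorm_translate_sub {f : V → E} (hf : MemLp f 2 μ) :
    Filter.Tendsto (fun t : V => eLpNorm (fun x => f (x - t) - f x) 2 μ) (𝓝 0) (𝓝 0) := by
  let shift : C(V, C(V, V)) := (ContinuousMap.mk (fun a : V × V => a.2 - a.1) (by fun_prop)).curry
  have hshift (t : V) : MeasurePreserving (shift t) μ μ := measurePreserving_sub_right μ t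
  have hcont : Continuous fun t : V =>
      Lp.compMeasurePreserving (p := 2) (shift t) (hshift t) (hf.toLp f) :=
    Continuous.compMeasurePreservingLp continuous_const shift.continuous hshift (by simp)
  refine (tendsto_iff_edist_tendsto_0.1 (hcont.tendsto 0)).congr fun t => ?_
  rw [Lp.toLp_compMeasurePreserving, Lp.toLp_compMeasurePreserving, Lp.edist_toLp_toLp]
  refine congrArg (fun u => eLpNorm u 2 μ) (funext fun x => ?_)
  simp [shift]

theorem exists_eLpNorm_convolution_sub_le [NormedSpace ℝ E] [CompleteSpace E] {f : V → E}
    (hf : MemLp f 2 μ) {ε : ENNReal} (hε : 0 < ε) :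
    ∃ δ > 0, ∀ ρ : V → ℝ, Continuous ρ → (∀ x, 0 ≤ ρ x) → Function.support ρ ⊆ Metric.ball 0 δ →
      ∫ x, ρ x ∂μ = 1 →
      eLpNorm (fun x => (ρ ⋆[ContinuousLinearMap.lsmul ℝ ℝ, μ] f) x - f x) 2 μ ≤ ε := by
  obtain ⟨δ, hδ, hclose⟩ := Metric.eventually_nhds_iff_ball.1
    ((tendsto_eLpNorm_translate_sub hf).eventually (Iic_mem_nhds hε))
  refine ⟨δ, hδ, fun ρ hρ hρ0 hsupp hρ1 => ?_⟩
  set ν : Measure V := μ.withDensity fun t => ENNReal.ofReal (ρ t) with hν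
  have : IsProbabilityMeasure ν := isProbabilityMeasure_withDensity_ofReal hρ0 hρ1
  have hνμ : ν ≪ μ := withDensity_absolutelyContinuous μ _
  have hρmeas : Measurable fun t => ENNReal.ofReal (ρ t) := hρ.measurable.ennreal_ofReal
  have integral_ν (u : V → E) : ∫ t, u t ∂ν = ∫ t, ρ t • u t ∂μ := by
    rw [hν, integral_withDensity_eq_integral_toReal_smul hρmeas (by simp)]
    simp only [ENNReal.toReal_ofReal (hρ0 _)]
  have hcs : HasCompactSupport ρ := HasCompactSupport.of_support_subset_isCompact
    (isCompact_closedBall 0 δ) (hsupp.trans Metric.ball_subset_closedBall)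
  have hconv := hcs.convolutionExists_left (ContinuousLinearMap.lsmul ℝ ℝ) (μ := μ) hρ
    (hf.locallyIntegrable (by norm_num))
  have hint : Integrable ρ μ := hρ.integrable_of_hasCompactSupport hcs
  have haverage (x : V) :
      (ρ ⋆[ContinuousLinearMap.lsmul ℝ ℝ, μ] f) x - f x = ∫ t, f (x - t) - f x ∂ν := by
    simp only [integral_ν, smul_sub, convolution_def, ContinuousLinearMap.lsmul_apply]
    rw [integral_sub (show Integrable (fun t => ρ t • f (x - t)) μ from hconv x)
      (hint.smul_const _), integral_smul_const, hρ1, one_smul]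
  simp only [haverage]
  have hf_meas := hf.aestronglyMeasurable
  refine eLpNorm_two_integral_le_of_ae_le ?_ ?_
  · exact ((hf_meas.comp_quasiMeasurePreserving
      (quasiMeasurePreserving_sub_of_right_invariant μ μ)).sub hf_meas.comp_fst).mono_ac
        (Measure.AbsolutelyContinuous.rfl.prod hνμ)
  · refine (ae_withDensity_iff hρmeas).2 (.of_forall fun t ht => hclose t (hsupp fun h => ht ?_))
    rw [h, ENNReal.ofReal_zero]

end Mollification

section Gradient

variable {E : Type*} [NormedAddCommGroup E] [InnerProductSpace ℝ E]

section Complete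

variable [CompleteSpace E] {f g : E → ℝ} {x : E}

theorem gradient_add (hf : DifferentiableAt ℝ f x) (hg : DifferentiableAt ℝ g x) :
    ∇ (f + g) x = ∇ f x + ∇ g x := by
  simp [gradient, fderiv_add hf hg]

theorem gradient_const_smul (hf : DifferentiableAt ℝ f x) (c : ℝ) :
    ∇ (c • f) x = c • ∇ f x := by
  simp [gradient, fderiv_const_smul hf]

theorem gradient_mul (hf : DifferentiableAt ℝ f x) (hg : DifferentiableAt ℝ g x) :
    ∇ (fun y => f y * g y) x = f x • ∇ g x + g x • ∇ f x := by
  simp [gradient, fderiv_fun_mul hf hg]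

theorem gradient_inner_right (a x : E) : ∇ (fun y => inner ℝ a y) x = a := by
  have h : HasFDerivAt (fun y => inner ℝ a y) (innerSL ℝ a) x := (innerSL ℝ a).hasFDerivAt
  rw [gradient, h.fderiv]
  exact (InnerProductSpace.toDual ℝ E).symm_apply_apply a

theorem norm_gradient (f : E → ℝ) (x : E) : ‖∇ f x‖ = ‖fderiv ℝ f x‖ := by
  rw [gradient, LinearIsometryEquiv.norm_map]

theorem norm_gradient_le_of_lipschitzWith {K : NNReal} (hf : LipschitzWith K f)
    (x : E) : ‖∇ f x‖ ≤ K :=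
  (norm_gradient f x).trans_le (norm_fderiv_le_of_lipschitz ℝ hf)

theorem gradient_eq_zero_of_notMem_tsupport (hx : x ∉ tsupport f) : ∇ f x = 0 := by
  have : fderiv ℝ f x = 0 := by
    by_contra h
    exact hx (support_fderiv_subset ℝ h)
  rw [gradient, this, map_zero]

theorem hasCompactSupport_gradient (hf : HasCompactSupport f) :
    HasCompactSupport fun x => ∇ f x :=
  HasCompactSupport.intro hf fun _ => gradient_eq_zero_of_notMem_tsupport

theorem continuous_gradient (hf : ContDiff ℝ 1 f) : Continuous fun x => ∇ f x :=
  (InnerProductSpace.toDual ℝ E).symm.continuous.comp (hf.continuous_fderiv one_ne_zero)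

end Complete

variable [FiniteDimensional ℝ E] [MeasurableSpace E] [BorelSpace E] {μ : Measure E}
  {f g : E → ℝ} {K : NNReal}

theorem measurable_gradient (f : E → ℝ) : Measurable fun x => ∇ f x :=
  (InnerProductSpace.toDual ℝ E).symm.continuous.measurable.comp (measurable_fderiv ℝ f)

theorem integrable_gradient_of_lipschitzWith [IsFiniteMeasureOnCompacts μ]
    (hf : LipschitzWith K f) (hf' : HasCompactSupport f) :
    Integrable (fun x => ∇ f x) μ := by
  have hbound : IntegrableOn (fun x => ∇ f x) (tsupport f) μ :=
    .of_bound hf'.isCompact.measure_lt_top (measurable_gradient f).aestronglyMeasurable K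
      (.of_forall fun x => norm_gradient_le_of_lipschitzWith hf x)
  exact (integrableOn_iff_integrable_of_support_subset fun x hx => by
    by_contra h
    exact hx (gradient_eq_zero_of_notMem_tsupport h)).1 hbound

variable [μ.IsAddHaarMeasure]

theorem integral_gradient_eq_zero_of_lipschitzWith (hf : LipschitzWith K f)
    (hf' : HasCompactSupport f) : ∫ x, ∇ f x ∂μ = 0 := by
  refine ext_inner_right ℝ fun a => ?_
  rw [inner_zero_left, real_inner_comm,
    ← integral_inner (integrable_gradient_of_lipschitzWith hf hf')]
  have hline : (fun x => inner ℝ a (∇ f x)) =ᵐ[μ] fun x => lineDeriv ℝ f x a := by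
    filter_upwards [hf.ae_differentiableAt] with x hx
    rw [inner_gradient_right, RCLike.conj_to_real, hx.lineDeriv_eq_fderiv]
  rw [integral_congr_ae hline]
  have h := (LipschitzWith.const (1 : ℝ)).integral_lineDeriv_mul_eq (μ := μ) hf hf' (-a)
  simpa [lineDeriv] using h.symm

theorem integral_smul_gradient_eq_neg (hf : ContDiff ℝ 1 f) (hg : ContDiff ℝ 1 g)
    (hg' : HasCompactSupport g) : ∫ x, f x • ∇ g x ∂μ = -∫ x, g x • ∇ f x ∂μ := by
  have hfg : Integrable (fun x => f x • ∇ g x) μ :=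
    (hf.continuous.smul (continuous_gradient hg)).integrable_of_hasCompactSupport
      (hasCompactSupport_gradient hg').smul_left
  have hgf : Integrable (fun x => g x • ∇ f x) μ :=
    (hg.continuous.smul (continuous_gradient hf)).integrable_of_hasCompactSupport hg'.smul_right
  obtain ⟨L, hL⟩ : ∃ L, LipschitzWith L fun x => f x * g x :=
    (hf.mul hg).lipschitzWith_of_hasCompactSupport hg'.mul_left one_ne_zero
  have h := integral_gradient_eq_zero_of_lipschitzWith (μ := μ) hL hg'.mul_left
  simp only [gradient_mul (hf.differentiable one_ne_zero _) (hg.differentiable one_ne_zero _)] at h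
  rwa [integral_add hfg hgf, ← eq_neg_iff_add_eq_zero] at h

end Gradient

section TestFunction

variable {d : ℕ} {Ω Ω' : Set (Space d)} {η κ : Space d → ℝ}

namespace IsTestFunction

theorem mono (hη : IsTestFunction Ω η) (h : Ω ⊆ Ω') : IsTestFunction Ω' η :=
  ⟨hη.smooth, hη.hasCompactSupport, hη.tsupport_subset.trans h⟩

theorem contDiff_one (hη : IsTestFunction Ω η) : ContDiff ℝ 1 η :=
  hη.smooth.of_le (by simp)

theorem differentiable (hη : IsTestFunction Ω η) : Differentiable ℝ η :=
  hη.smooth.differentiable (by simp)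

theorem continuous (hη : IsTestFunction Ω η) : Continuous η :=
  hη.smooth.continuous

theorem zero : IsTestFunction Ω (0 : Space d → ℝ) :=
  ⟨contDiff_const, HasCompactSupport.zero, by simp [tsupport]⟩

theorem add (hη : IsTestFunction Ω η) (hκ : IsTestFunction Ω κ) : IsTestFunction Ω (η + κ) :=
  ⟨hη.smooth.add hκ.smooth, hη.hasCompactSupport.add hκ.hasCompactSupport,
    (tsupport_add η κ).trans (union_subset hη.tsupport_subset hκ.tsupport_subset)⟩

theorem const_smul (hη : IsTestFunction Ω η) (c : ℝ) : IsTestFunction Ω (c • η) :=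
  ⟨contDiff_const.smul hη.smooth, hη.hasCompactSupport.smul_left (f := fun _ => c),
    (tsupport_smul_subset_right (fun _ => c) η).trans hη.tsupport_subset⟩

theorem mul_left (hη : IsTestFunction Ω η) {f : Space d → ℝ} (hf : ContDiff ℝ (⊤ : ℕ∞) f) :
    IsTestFunction Ω (fun x => f x * η x) :=
  ⟨hf.mul hη.smooth, hη.hasCompactSupport.mul_left,
    (tsupport_mul_subset_right (f := f) (g := η)).trans hη.tsupport_subset⟩

theorem setIntegral_eq {E : Type*} [NormedAddCommGroup E] [NormedSpace ℝ E]
    (hη : IsTestFunction Ω η) {F : Space d → E} (hF : ∀ x ∉ tsupport η, F x = 0) :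
    ∫ x in Ω, F x = ∫ x, F x :=
  setIntegral_eq_integral_of_forall_compl_eq_zero fun x hx =>
    hF x fun h => hx (hη.tsupport_subset h)

theorem memLp_restrict (hη : IsTestFunction Ω' η) (S : Set (Space d)) (p : ENNReal) :
    MemLp η p (volume.restrict S) :=
  (hη.continuous.memLp_of_hasCompactSupport hη.hasCompactSupport).restrict S

theorem memLp_gradient_restrict (hη : IsTestFunction Ω' η) (S : Set (Space d)) (p : ENNReal) :
    MemLp (fun x => ∇ η x) p (volume.restrict S) :=
  (hη.continuous_gradient.memLp_of_hasCompactSupport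
    (hasCompactSupport_gradient hη.hasCompactSupport)).restrict S

theorem continuous_setIntegral_smul_gradient (hη : IsTestFunction Ω' η) :
    Continuous fun φ : L2 Ω => ∫ x in Ω, φ x • ∇ η x := by
  have hpair (φ : L2 Ω) : ∫ x in Ω, φ x • ∇ η x =
      (ContinuousLinearMap.lsmul ℝ ℝ).lpPairing _ 2 2 φ
        ((hη.memLp_gradient_restrict Ω 2).toLp _) := by
    rw [ContinuousLinearMap.lpPairing_eq_integral]
    refine integral_congr_ae ?_
    filter_upwards [(hη.memLp_gradient_restrict Ω 2).coeFn_toLp] with x hx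
    rw [hx, ContinuousLinearMap.lsmul_apply]
  simp only [hpair]
  fun_prop

theorem continuous_setIntegral_smul (hη : IsTestFunction Ω' η) :
    Continuous fun G : L2Vec Ω => ∫ x in Ω, η x • G x := by
  have hpair (G : L2Vec Ω) : ∫ x in Ω, η x • G x =
      (ContinuousLinearMap.lsmul ℝ ℝ).lpPairing _ 2 2 ((hη.memLp_restrict Ω 2).toLp _) G := by
    rw [ContinuousLinearMap.lpPairing_eq_integral]
    refine integral_congr_ae ?_
    filter_upwards [(hη.memLp_restrict Ω 2).coeFn_toLp] with x hx
    rw [hx, ContinuousLinearMap.lsmul_apply]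
  simp only [hpair]
  fun_prop

theorem setIntegral_smul_gradient_eq_neg (hη : IsTestFunction Ω η) {f : Space d → ℝ}
    (hf : ContDiff ℝ 1 f) : ∫ x in Ω, f x • ∇ η x = -∫ x in Ω, η x • ∇ f x := by
  rw [hη.setIntegral_eq fun x hx => by rw [gradient_eq_zero_of_notMem_tsupport hx, smul_zero],
    hη.setIntegral_eq fun x hx => by rw [image_eq_zero_of_notMem_tsupport hx, zero_smul]]
  exact integral_smul_gradient_eq_neg hf hη.contDiff_one hη.hasCompactSupport

end IsTestFunction

theorem isClosed_H1 : IsClosed (H1 Ω : Set (L2 Ω × L2Vec Ω)) := by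
  have h_inter : (H1 Ω : Set (L2 Ω × L2Vec Ω)) = ⋂ (η : Space d → ℝ) (_ : IsTestFunction Ω η),
      {p | ∫ x in Ω, p.1 x • ∇ η x = -∫ x in Ω, η x • p.2 x} := by
    ext p
    simp only [mem_iInter]
    rfl
  rw [h_inter]
  exact isClosed_iInter fun η => isClosed_iInter fun hη =>
    isClosed_eq (hη.continuous_setIntegral_smul_gradient.comp continuous_fst)
      (hη.continuous_setIntegral_smul.comp continuous_snd).neg

theorem isWeakDivergence_iff {σ : L2Vec Ω} {f : L2 Ω} :
    IsWeakDivergence Ω σ f ↔ ∀ η : Space d → ℝ, ∀ hη : IsTestFunction Ω η,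
      inner ℝ ((hη.memLp_gradient_restrict Ω 2).toLp _) σ +
        inner ℝ ((hη.memLp_restrict Ω 2).toLp _) f = 0 := by
  refine forall₂_congr fun η hη => ?_
  have h_field : inner ℝ ((hη.memLp_gradient_restrict Ω 2).toLp _) σ =
      ∫ x in Ω, inner ℝ (σ x) (∇ η x) := by
    rw [L2.inner_def]
    refine integral_congr_ae ?_
    filter_upwards [(hη.memLp_gradient_restrict Ω 2).coeFn_toLp] with x hx
    rw [hx, real_inner_comm]
  have h_div : inner ℝ ((hη.memLp_restrict Ω 2).toLp _) f = ∫ x in Ω, η x * f x := by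
    rw [L2.inner_def]
    refine integral_congr_ae ?_
    filter_upwards [(hη.memLp_restrict Ω 2).coeFn_toLp] with x hx
    rw [hx, Real.inner_apply]
  rw [h_field, h_div, eq_neg_iff_add_eq_zero]

end TestFunction

section TestGraph

variable {d : ℕ} {Ω Ω' : Set (Space d)} {η : Space d → ℝ}

/-- The pairs `(η|_Ω, ∇η|_Ω)` for `η ∈ C_c^∞(Ω')`. With `Ω' = Ω` they generate `H¹₀(Ω)`, with
`Ω' = ℝ^d` they approximate all of `H¹(Ω)`. -/
noncomputable def testGraph (Ω' Ω : Set (Space d)) : Submodule ℝ (L2 Ω × L2Vec Ω) where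
  carrier := {p | ∃ η : Space d → ℝ, IsTestFunction Ω' η ∧ p.1 =ᵐ[volume.restrict Ω] η ∧
    p.2 =ᵐ[volume.restrict Ω] fun x => ∇ η x}
  zero_mem' := by
    refine ⟨0, .zero, Lp.coeFn_zero _ _ _, (Lp.coeFn_zero _ _ _).trans (.of_forall fun x => ?_)⟩
    exact (gradient_fun_const x (0 : ℝ)).symm
  add_mem' := by
    rintro p q ⟨η, hη, hp, hp'⟩ ⟨κ, hκ, hq, hq'⟩
    refine ⟨η + κ, hη.add hκ, (Lp.coeFn_add p.1 q.1).trans (hp.add hq), ?_⟩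
    filter_upwards [Lp.coeFn_add p.2 q.2, hp', hq'] with x hx hpx hqx
    rw [gradient_add (hη.differentiable x) (hκ.differentiable x), ← hpx, ← hqx]
    exact hx
  smul_mem' := by
    rintro c p ⟨η, hη, hp, hp'⟩
    refine ⟨c • η, hη.const_smul c, (Lp.coeFn_smul c p.1).trans (hp.const_smul c), ?_⟩
    filter_upwards [Lp.coeFn_smul c p.2, hp'] with x hx hpx
    rw [gradient_const_smul (hη.differentiable x), ← hpx]
    exact hx

theorem IsTestFunction.toLp_mem_testGraph (hη : IsTestFunction Ω' η) :
    ((hη.memLp_restrict Ω 2).toLp η, (hη.memLp_gradient_restrict Ω 2).toLp fun x => ∇ η x) ∈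
      testGraph Ω' Ω :=
  ⟨η, hη, (hη.memLp_restrict Ω 2).coeFn_toLp, (hη.memLp_gradient_restrict Ω 2).coeFn_toLp⟩

theorem mem_testGraph_iff {p : L2 Ω × L2Vec Ω} :
    p ∈ testGraph Ω' Ω ↔ ∃ (η : Space d → ℝ) (hη : IsTestFunction Ω' η),
      p = ((hη.memLp_restrict Ω 2).toLp η,
        (hη.memLp_gradient_restrict Ω 2).toLp fun x => ∇ η x) := by
  constructor
  · rintro ⟨η, hη, hp, hp'⟩
    exact ⟨η, hη, Prod.ext (Lp.ext (hp.trans (hη.memLp_restrict Ω 2).coeFn_toLp.symm))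
      (Lp.ext (hp'.trans (hη.memLp_gradient_restrict Ω 2).coeFn_toLp.symm))⟩
  · rintro ⟨η, hη, rfl⟩
    exact hη.toLp_mem_testGraph

theorem edist_toLp_left {α E : Type*} [MeasurableSpace α] [NormedAddCommGroup E] {μ : Measure α}
    {p : ENNReal} {f : α → E} (hf : MemLp f p μ) (g : Lp E p μ) :
    edist (hf.toLp f) g = eLpNorm (fun x => f x - g x) p μ := by
  conv_lhs => rw [← Lp.toLp_coeFn g (Lp.memLp g), Lp.edist_toLp_toLp]
  rfl

theorem mem_closure_testGraph {p : L2 Ω × L2Vec Ω}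
    (h : ∀ ε : ENNReal, 0 < ε → ∃ η, IsTestFunction Ω' η ∧
      eLpNorm (fun x => η x - p.1 x) 2 (volume.restrict Ω) ≤ ε ∧
      eLpNorm (fun x => ∇ η x - p.2 x) 2 (volume.restrict Ω) ≤ ε) :
    p ∈ (testGraph Ω' Ω).topologicalClosure := by
  refine EMetric.mem_closure_iff.2 fun ε hε => ?_
  obtain ⟨δ, hδ, hδε⟩ := exists_between hε
  obtain ⟨η, hη, hle, hle'⟩ := h δ hδ
  refine ⟨_, hη.toLp_mem_testGraph, ?_⟩
  rw [edist_comm, Prod.edist_eq, edist_toLp_left, edist_toLp_left]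
  exact (max_le hle hle').trans_lt hδε

/-- `H¹₀(Ω)`, the closure of `C_c^∞(Ω)` in `H¹(Ω)`, as a space of pairs `(φ, ∇φ)`. -/
noncomputable def H10 (Ω : Set (Space d)) : Submodule ℝ (L2 Ω × L2Vec Ω) :=
  (testGraph Ω Ω).topologicalClosure

theorem isClosed_H10 : IsClosed (H10 Ω : Set (L2 Ω × L2Vec Ω)) :=
  Submodule.isClosed_topologicalClosure _

theorem testGraph_le_H10 : testGraph Ω Ω ≤ H10 Ω := Submodule.le_topologicalClosure _

theorem H10_le_H1 : H10 Ω ≤ H1 Ω := by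
  refine Submodule.topologicalClosure_minimal _ ?_ isClosed_H1
  rintro p ⟨η, hη, hp, hp'⟩ κ hκ
  calc ∫ x in Ω, p.1 x • ∇ κ x = ∫ x in Ω, η x • ∇ κ x :=
        integral_congr_ae (hp.mono fun x hx => by simp only [hx])
    _ = -∫ x in Ω, κ x • ∇ η x := hκ.setIntegral_smul_gradient_eq_neg hη.contDiff_one
    _ = -∫ x in Ω, κ x • p.2 x :=
        congrArg Neg.neg (integral_congr_ae (hp'.mono fun x hx => by simp only [hx]))

theorem inner_add_inner_eq_zero_of_mem_H10 {p : L2 Ω × L2Vec Ω} (hp : p ∈ H10 Ω) {σ : L2Vec Ω}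
    {f : L2 Ω} (hσ : IsWeakDivergence Ω σ f) : inner ℝ p.2 σ + inner ℝ p.1 f = 0 := by
  have hclosed : IsClosed {p : L2 Ω × L2Vec Ω | inner ℝ p.2 σ + inner ℝ p.1 f = 0} :=
    isClosed_eq (by fun_prop) (by fun_prop)
  refine closure_minimal (fun q hq => ?_) hclosed hp
  obtain ⟨η, hη, rfl⟩ := mem_testGraph_iff.1 hq
  exact isWeakDivergence_iff.1 hσ η hη

end TestGraph

section Poincare

variable {d : ℕ} {Ω : Set (Space d)} {η : Space d → ℝ}

/- This is `∫ ∂_a (⟨a, x⟩ η²) = 0`, expanded. -/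
theorem integral_mul_self_eq (hη : ContDiff ℝ 1 η) (hη' : HasCompactSupport η) {a : Space d}
    (ha : ‖a‖ = 1) :
    ∫ x, η x * η x = ∫ x, η x * ((-2 * inner ℝ a x) * inner ℝ a (∇ η x)) := by
  have hη2 : ContDiff ℝ 1 fun x => η x * η x := hη.mul hη
  have hη2' : HasCompactSupport fun x => η x * η x := hη'.mul_left
  have hlin : ContDiff ℝ 1 fun x : Space d => inner ℝ a x := (innerSL ℝ a).contDiff
  have hint : Integrable fun x => inner ℝ a x • ∇ (fun y => η y * η y) x :=
    (hlin.continuous.smul (continuous_gradient hη2)).integrable_of_hasCompactSupport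
      (hasCompactSupport_gradient hη2').smul_left
  have hparts := congrArg (inner ℝ a) (integral_smul_gradient_eq_neg (μ := volume) hlin hη2 hη2')
  simp only [gradient_inner_right] at hparts
  rw [inner_neg_right, integral_smul_const, real_inner_smul_right, real_inner_self_eq_norm_sq, ha,
    one_pow, mul_one, ← integral_inner hint, eq_comm, neg_eq_iff_eq_neg,
    ← integral_neg] at hparts
  refine hparts.trans (integral_congr_ae (.of_forall fun x => ?_))
  have hdiff := hη.differentiable one_ne_zero x
  simp only [gradient_mul hdiff hdiff, inner_add_right, real_inner_smul_right]
  ring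

theorem IsTestFunction.norm_toLp_le (hη : IsTestFunction Ω η) (hΩ : MeasurableSet Ω)
    {a : Space d} (ha : ‖a‖ = 1) {R : ℝ} (hR : ∀ x ∈ Ω, ‖x‖ ≤ R) :
    ‖(hη.memLp_restrict Ω 2).toLp η‖ ≤
      2 * R * ‖(hη.memLp_gradient_restrict Ω 2).toLp fun x => ∇ η x‖ := by
  have hηLp := hη.memLp_restrict Ω 2
  have hw : MemLp (fun x => (-2 * inner ℝ a x) * inner ℝ a (∇ η x)) 2 (volume.restrict Ω) := by
    have hcont := hη.continuous_gradient
    refine (Continuous.memLp_of_hasCompactSupport (by fun_prop)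
      (.intro hη.hasCompactSupport fun x hx => ?_)).restrict Ω
    simp [gradient_eq_zero_of_notMem_tsupport hx]
  have hw_norm : ‖hw.toLp _‖ ≤
      2 * R * ‖(hη.memLp_gradient_restrict Ω 2).toLp fun x => ∇ η x‖ := by
    refine Lp.norm_le_mul_norm_of_ae_le_mul ?_
    filter_upwards [hw.coeFn_toLp, (hη.memLp_gradient_restrict Ω 2).coeFn_toLp,
      ae_restrict_mem hΩ] with x hwx hηx hxΩ
    have hle (y : Space d) : |inner ℝ a y| ≤ ‖y‖ := by simpa [ha] using abs_real_inner_le_norm a y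
    rw [hwx, hηx, Real.norm_eq_abs, abs_mul, abs_mul, abs_neg, abs_two]
    gcongr
    exacts [mul_nonneg two_pos.le ((norm_nonneg x).trans (hR x hxΩ)),
      (hle x).trans (hR x hxΩ), hle _]
  have hsq : ‖hηLp.toLp η‖ * ‖hηLp.toLp η‖ = inner ℝ (hηLp.toLp η) (hw.toLp _) := by
    rw [← real_inner_self_eq_norm_mul_norm, L2.inner_def, L2.inner_def]
    calc _ = ∫ x in Ω, η x * η x :=
          integral_congr_ae (hηLp.coeFn_toLp.mono fun x hx => by simp only [hx, Real.inner_apply])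
      _ = ∫ x in Ω, η x * ((-2 * inner ℝ a x) * inner ℝ a (∇ η x)) := by
          rw [hη.setIntegral_eq fun x hx => by simp [image_eq_zero_of_notMem_tsupport hx],
            hη.setIntegral_eq fun x hx => by simp [image_eq_zero_of_notMem_tsupport hx]]
          exact integral_mul_self_eq hη.contDiff_one hη.hasCompactSupport ha
      _ = _ := integral_congr_ae (by
          filter_upwards [hηLp.coeFn_toLp, hw.coeFn_toLp] with x hx hwx
          simp only [hx, hwx, Real.inner_apply])
  refine le_trans ?_ hw_norm
  by_contra! hlt
  have hpos := (norm_nonneg _).trans_lt hlt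
  exact (mul_lt_mul_of_pos_left hlt hpos).not_ge (hsq.trans_le (real_inner_le_norm _ _))

theorem exists_norm_fst_le_of_mem_H10 (hd : 0 < d) (hΩ : MeasurableSet Ω)
    (hb : Bornology.IsBounded Ω) :
    ∃ C : NNReal, ∀ p ∈ H10 Ω, ‖p.1‖ ≤ C * ‖p.2‖ := by
  obtain ⟨R, hR⟩ := hb.exists_norm_le
  have ha : ‖EuclideanSpace.single (⟨0, hd⟩ : Fin d) (1 : ℝ)‖ = 1 := by simp
  refine ⟨Real.toNNReal (2 * R), fun p hp => ?_⟩
  have hclosed : IsClosed {p : L2 Ω × L2Vec Ω | ‖p.1‖ ≤ Real.toNNReal (2 * R) * ‖p.2‖} :=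
    isClosed_le (by fun_prop) (by fun_prop)
  refine closure_minimal (fun q hq => ?_) hclosed hp
  obtain ⟨η, hη, rfl⟩ := mem_testGraph_iff.1 hq
  exact (hη.norm_toLp_le hΩ ha hR).trans
    (mul_le_mul_of_nonneg_right (Real.le_coe_toNNReal _) (norm_nonneg _))

end Poincare

section Geometry

variable {d : ℕ} {Ω : Set (Space d)}

/-- In `B`, the set `Ω` consists of the points strictly below the graph of the `K`-Lipschitz
function `h`, where `e` is the vertical direction. -/
structure IsSubgraphIn (Ω B : Set (Space d)) (e : Space d) (K : NNReal)
    (h : (Submodule.span ℝ {e})ᗮ → ℝ) : Prop where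
  norm_eq_one : ‖e‖ = 1
  lipschitzWith : LipschitzWith K h
  mem_iff : ∀ y ∈ B,
    y ∈ Ω ↔ inner ℝ e y < h ((Submodule.span ℝ {e})ᗮ.orthogonalProjectionOnto y)

/-- The sets on which the analysis of `Ω` is carried out: those contained in `Ω`, and those well
inside a ball where `Ω` is a Lipschitz subgraph. -/
def IsLipschitzCell (Ω S : Set (Space d)) : Prop :=
  S ⊆ Ω ∨ ∃ (x : Space d) (r : ℝ) (e : Space d) (K : NNReal)
    (h : (Submodule.span ℝ {e})ᗮ → ℝ), 0 < r ∧ S ⊆ Metric.ball x (r / 2) ∧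
      IsSubgraphIn Ω (Metric.ball x r) e K h

theorem IsLipschitzCell.mono {S T : Set (Space d)} (hT : IsLipschitzCell Ω T) (h : S ⊆ T) :
    IsLipschitzCell Ω S := by
  rcases hT with hT | ⟨x, r, e, K, h', hr, hT, hg⟩
  · exact .inl (h.trans hT)
  · exact .inr ⟨x, r, e, K, h', hr, h.trans hT, hg⟩

/-- Moving a point of `closure Ω` by `-t • e`, up to an error `c * t`, leads into `Ω`, if the
starting point or the end point lies in `S`. -/
def ShiftsInto (Ω S : Set (Space d)) (e : Space d) : Prop :=
  ∃ c > 0, ∃ t₀ > 0, ∀ t : ℝ, 0 < t → t < t₀ → ∀ y ∈ closure Ω, ∀ z : Space d, ‖z‖ ≤ c * t →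
    (y ∈ S ∨ y - t • e + z ∈ S) → y - t • e + z ∈ Ω

theorem shiftsInto_zero_of_isCompact (hΩ : IsOpen Ω) {S : Set (Space d)} (hS : IsCompact S)
    (h : S ⊆ Ω) : ShiftsInto Ω S 0 := by
  obtain ⟨δ, hδ, hsub⟩ := hS.exists_cthickening_subset_open hΩ h
  refine ⟨1, one_pos, δ, hδ, fun t _ ht y _ z hz hyz => ?_⟩
  rcases hyz with hy | hy
  · refine hsub (Metric.mem_cthickening_of_dist_le _ y _ _ hy ?_)
    simp only [smul_zero, sub_zero, dist_self_add_left]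
    linarith
  · exact h hy

namespace IsSubgraphIn

variable {B : Set (Space d)} {e : Space d} {K : NNReal} {h : (Submodule.span ℝ {e})ᗮ → ℝ}

theorem continuous_height (hg : IsSubgraphIn Ω B e K h) :
    Continuous fun y => h ((Submodule.span ℝ {e})ᗮ.orthogonalProjectionOnto y) :=
  hg.lipschitzWith.continuous.comp (by fun_prop)

theorem inner_le_of_mem_closure (hg : IsSubgraphIn Ω B e K h) (hB : IsOpen B) {y : Space d}
    (hyB : y ∈ B) (hy : y ∈ closure Ω) :
    inner ℝ e y ≤ h ((Submodule.span ℝ {e})ᗮ.orthogonalProjectionOnto y) := by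
  by_contra! hlt
  have hopen : IsOpen ({y | h ((Submodule.span ℝ {e})ᗮ.orthogonalProjectionOnto y) < inner ℝ e y}
      ∩ B) := (isOpen_lt hg.continuous_height (by fun_prop)).inter hB
  obtain ⟨w, ⟨hw_above, hwB⟩, hwΩ⟩ := mem_closure_iff.1 hy _ hopen ⟨hlt, hyB⟩
  exact lt_asymm hw_above ((hg.mem_iff w hwB).1 hwΩ)

theorem sub_smul_add_mem (hg : IsSubgraphIn Ω B e K h) (hB : IsOpen B) {y z : Space d} {t : ℝ}
    (hyB : y ∈ B) (hy : y ∈ closure Ω) (hyzB : y - t • e + z ∈ B) (hz : (1 + K) * ‖z‖ < t) :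
    y - t • e + z ∈ Ω := by
  rw [hg.mem_iff _ hyzB]
  have h_inner : inner ℝ e (y - t • e + z) ≤ inner ℝ e y - t + ‖z‖ := by
    have hez : inner ℝ e z ≤ ‖z‖ := by simpa [hg.norm_eq_one] using real_inner_le_norm e z
    rw [inner_add_right, inner_sub_right, real_inner_smul_right, real_inner_self_eq_norm_sq,
      hg.norm_eq_one]
    linarith
  have h_height : h ((Submodule.span ℝ {e})ᗮ.orthogonalProjectionOnto y) - K * ‖z‖ ≤
      h ((Submodule.span ℝ {e})ᗮ.orthogonalProjectionOnto (y - t • e + z)) := by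
    rw [map_add, map_sub, map_smul,
      Submodule.orthogonalProjectionOnto_orthogonalComplement_singleton_eq_zero, smul_zero,
      sub_zero, sub_le_comm]
    refine (le_abs_self _).trans ((hg.lipschitzWith.dist_le_mul _ _).trans ?_)
    rw [dist_self_add_right]
    gcongr
    exact Submodule.norm_orthogonalProjectionOnto_apply_le _ z
  linarith [hg.inner_le_of_mem_closure hB hyB hy]

theorem shiftsInto {x : Space d} {r : ℝ} (hr : 0 < r)
    (hg : IsSubgraphIn Ω (Metric.ball x r) e K h) {S : Set (Space d)}
    (hS : S ⊆ Metric.ball x (r / 2)) : ShiftsInto Ω S e := by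
  refine ⟨1 / (2 * (1 + K)), by positivity, r / 4, by positivity, ?_⟩
  intro t ht ht_lt y hy z hz hyS
  have hz_half : (1 + K) * ‖z‖ ≤ t / 2 := by
    calc (1 + K) * ‖z‖ ≤ (1 + K) * (1 / (2 * (1 + K)) * t) := by gcongr
      _ = t / 2 := by field_simp
  have hz_le : ‖z‖ ≤ t / 2 := by nlinarith [norm_nonneg z]
  have hdist : dist (y - t • e + z) y < r / 2 := by
    rw [dist_eq_norm]
    calc ‖y - t • e + z - y‖ = ‖z - t • e‖ := by congr 1; abel
      _ ≤ ‖z‖ + ‖t • e‖ := norm_sub_le _ _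
      _ = ‖z‖ + t := by rw [norm_smul, hg.norm_eq_one, Real.norm_of_nonneg ht.le, mul_one]
      _ < r / 2 := by linarith
  have hball {a b : Space d} (hab : dist b a < r / 2) (ha : a ∈ S) :
      a ∈ Metric.ball x r ∧ b ∈ Metric.ball x r := by
    have hax := Metric.mem_ball.1 (hS ha)
    exact ⟨Metric.mem_ball.2 (by linarith),
      Metric.mem_ball.2 (by linarith [dist_triangle b a x])⟩
  obtain ⟨hyB, hyzB⟩ : y ∈ Metric.ball x r ∧ y - t • e + z ∈ Metric.ball x r :=
    hyS.elim (hball hdist) fun h => (hball (by rwa [dist_comm]) h).symm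
  exact hg.sub_smul_add_mem Metric.isOpen_ball hyB hy hyzB (by linarith)

end IsSubgraphIn

theorem IsLipschitzCell.exists_shiftsInto {S : Set (Space d)} (hS : IsLipschitzCell Ω S)
    (hΩ : IsOpen Ω) (hc : IsCompact S) : ∃ e, ShiftsInto Ω S e := by
  rcases hS with hS | ⟨x, r, e, K, h, hr, hS, hg⟩
  · exact ⟨0, shiftsInto_zero_of_isCompact hΩ hc hS⟩
  · exact ⟨e, hg.shiftsInto hr hS⟩

namespace IsBoundedLipschitzDomain

theorem exists_isLipschitzCell_nhd (hΩ : IsBoundedLipschitzDomain Ω) {x : Space d}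
    (hx : x ∈ closure Ω) :
    ∃ U, IsOpen U ∧ x ∈ U ∧ Bornology.IsBounded U ∧ IsLipschitzCell Ω U := by
  by_cases hxΩ : x ∈ Ω
  · exact ⟨Ω, hΩ.isOpen, hxΩ, hΩ.isBounded, .inl subset_rfl⟩
  · have hx_frontier : x ∈ frontier Ω := ⟨hx, by rwa [hΩ.isOpen.interior_eq]⟩
    obtain ⟨e, he, K, h, hLip, r, hr, hmem⟩ := hΩ.locally_subgraph x hx_frontier
    exact ⟨Metric.ball x (r / 2), Metric.isOpen_ball, Metric.mem_ball_self (by positivity),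
      Metric.isBounded_ball, .inr ⟨x, r, e, K, h, hr, subset_rfl, he, hLip, hmem⟩⟩

theorem exists_partition (hΩ : IsBoundedLipschitzDomain Ω) :
    ∃ (ι : Type) (_ : Fintype ι) (θ : ι → Space d → ℝ),
      (∀ i, IsTestFunction univ (θ i)) ∧ (∀ i x, 0 ≤ θ i x) ∧
      (∀ x ∈ closure Ω, ∑ i, θ i x = 1) ∧ ∀ i, IsLipschitzCell Ω (tsupport (θ i)) := by
  choose! U hUo hxU hUb hU using fun x => hΩ.exists_isLipschitzCell_nhd (x := x)
  obtain ⟨t, ht_closure, ht_cover⟩ := hΩ.isBounded.isCompact_closure.elim_nhds_subcover U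
    fun x hx => (hUo x hx).mem_nhds (hxU x hx)
  obtain ⟨f, hf⟩ := SmoothPartitionOfUnity.exists_isSubordinate (modelWithCornersSelf ℝ (Space d))
    isClosed_closure (fun i : t => U i) (fun i => hUo i (ht_closure i i.2))
    (fun x hx => by simpa using ht_cover hx)
  refine ⟨t, inferInstance, fun i => f i, fun i => ⟨(f i).contMDiff.contDiff, ?_, subset_univ _⟩,
    f.nonneg, fun x hx => ?_, fun i => (hU i (ht_closure i i.2)).mono (hf i)⟩
  · exact Metric.isCompact_of_isClosed_isBounded (isClosed_tsupport _)
      ((hUb i (ht_closure i i.2)).subset (hf i))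
  · rw [← finsum_eq_sum_of_fintype]
    exact f.sum_eq_one hx

end IsBoundedLipschitzDomain

end Geometry

section Density

open scoped Pointwise Convolution

variable {d : ℕ} {Ω Ω' : Set (Space d)} {θ ρ : Space d → ℝ}

theorem IsTestFunction.reflect_translate (hρ : IsTestFunction Ω' ρ) (y : Space d) :
    IsTestFunction univ fun w => ρ (y - w) :=
  ⟨hρ.smooth.comp (contDiff_const.sub contDiff_id),
    hρ.hasCompactSupport.comp_homeomorph (Homeomorph.subLeft y), subset_univ _⟩

theorem IsTestFunction.gradient_reflect_translate (hρ : IsTestFunction Ω' ρ) (y w : Space d) :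
    ∇ (fun w => ρ (y - w)) w = -∇ ρ (y - w) := by
  have h : HasFDerivAt (fun w => ρ (y - w)) (-(fderiv ℝ ρ (y - w))) w :=
    HasFDerivAt.congr_fderiv
      ((hρ.differentiable (y - w)).hasFDerivAt.comp w ((hasFDerivAt_id w).const_sub y))
      (by ext; simp)
  rw [gradient, h.fderiv, map_neg, gradient]

theorem IsTestFunction.gradient_convolution (hρ : IsTestFunction Ω' ρ) {f : Space d → ℝ}
    (hf : LocallyIntegrable f) (y : Space d) :
    ∇ (ρ ⋆[ContinuousLinearMap.lsmul ℝ ℝ] f) y = -∫ w, f w • ∇ (fun w => ρ (y - w)) w := by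
  have h := hρ.hasCompactSupport.hasFDerivAt_convolution_left (ContinuousLinearMap.lsmul ℝ ℝ)
    hρ.contDiff_one hf y
  rw [gradient, h.fderiv, convolution_eq_swap, ← integral_neg]
  refine ((InnerProductSpace.toDual ℝ (Space d)).symm.toContinuousLinearEquiv.integral_comp_comm
    _).symm.trans (integral_congr_ae (.of_forall fun w => ?_))
  beta_reduce
  rw [hρ.gradient_reflect_translate, smul_neg, neg_neg, gradient, ← map_smul]
  refine congrArg (InnerProductSpace.toDual ℝ (Space d)).symm ?_
  ext v
  simp [mul_comm]

/-- `θ φ`, extended by zero outside `Ω`. -/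
noncomputable def cutFn (Ω : Set (Space d)) (θ : Space d → ℝ) (φ : L2 Ω) : Space d → ℝ :=
  Ω.indicator fun x => θ x * φ x

/-- `∇(θ φ) = θ G + φ ∇θ` for `G = ∇φ`, extended by zero outside `Ω`. -/
noncomputable def cutGrad (Ω : Set (Space d)) (θ : Space d → ℝ) (φ : L2 Ω) (G : L2Vec Ω) :
    Space d → Space d :=
  Ω.indicator fun x => θ x • G x + φ x • ∇ θ x

namespace IsTestFunction

theorem memLp_mul (hθ : IsTestFunction Ω' θ) (φ : L2 Ω) :
    MemLp (fun x => θ x * φ x) 2 (volume.restrict Ω) :=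
  (Lp.memLp φ).mul (hθ.memLp_restrict Ω ⊤)

theorem memLp_smul_add (hθ : IsTestFunction Ω' θ) (φ : L2 Ω) (G : L2Vec Ω) :
    MemLp (fun x => θ x • G x + φ x • ∇ θ x) 2 (volume.restrict Ω) :=
  ((Lp.memLp G).smul (hθ.memLp_restrict Ω ⊤)).add
    ((hθ.memLp_gradient_restrict Ω ⊤).smul (Lp.memLp φ))

theorem memLp_cutFn (hθ : IsTestFunction Ω' θ) (hΩ : MeasurableSet Ω) (φ : L2 Ω) :
    MemLp (cutFn Ω θ φ) 2 volume :=
  (memLp_indicator_iff_restrict hΩ).2 (hθ.memLp_mul φ)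

theorem memLp_cutGrad (hθ : IsTestFunction Ω' θ) (hΩ : MeasurableSet Ω) (φ : L2 Ω)
    (G : L2Vec Ω) : MemLp (cutGrad Ω θ φ G) 2 volume :=
  (memLp_indicator_iff_restrict hΩ).2 (hθ.memLp_smul_add φ G)

/- The hypothesis says that `G = ∇φ` may be tested against `w ↦ ρ (y - w) * θ w`. -/
theorem gradient_convolution_cutFn (hρ : IsTestFunction Ω' ρ) (hθ : IsTestFunction Ω' θ)
    (hΩ : MeasurableSet Ω) (φ : L2 Ω) (G : L2Vec Ω) (y : Space d)
    (h : ∫ x in Ω, φ x • ∇ (fun w => ρ (y - w) * θ w) x =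
      -∫ x in Ω, (ρ (y - x) * θ x) • G x) :
    ∇ (ρ ⋆[ContinuousLinearMap.lsmul ℝ ℝ] cutFn Ω θ φ) y =
      (ρ ⋆[ContinuousLinearMap.lsmul ℝ ℝ] cutGrad Ω θ φ G) y := by
  set r : Space d → ℝ := fun w => ρ (y - w) with hr_def
  have hr : IsTestFunction univ r := hρ.reflect_translate y
  have hκ : IsTestFunction univ fun w => r w * θ w :=
    (hθ.mono (subset_univ _)).mul_left hr.smooth
  have h_smul_grad {κ : Space d → ℝ} (hκ : IsTestFunction univ κ) {u : Space d → ℝ}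
      (hu : MemLp u 2 (volume.restrict Ω)) : IntegrableOn (fun w => u w • ∇ κ w) Ω :=
    memLp_one_iff_integrable.1 ((hκ.memLp_gradient_restrict Ω 2).smul hu)
  have h_smul {κ : Space d → ℝ} (hκ : IsTestFunction univ κ) {F : Space d → Space d}
      (hF : MemLp F 2 (volume.restrict Ω)) : IntegrableOn (fun w => κ w • F w) Ω :=
    memLp_one_iff_integrable.1 (hF.smul (hκ.memLp_restrict Ω 2))
  have h_product (w : Space d) : r w • (θ w • G w + φ w • ∇ θ w) + (θ w * φ w) • ∇ r w =
      (r w * θ w) • G w + φ w • ∇ (fun w => r w * θ w) w := by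
    rw [gradient_mul (hr.differentiable w) (hθ.differentiable w)]
    module
  have h_sum : (∫ w in Ω, r w • (θ w • G w + φ w • ∇ θ w)) +
      ∫ w in Ω, (θ w * φ w) • ∇ r w = 0 := by
    rw [← integral_add (h_smul hr (hθ.memLp_smul_add φ G)) (h_smul_grad hr (hθ.memLp_mul φ))]
    simp only [h_product]
    rw [integral_add (h_smul hκ (Lp.memLp G)) (h_smul_grad hκ (Lp.memLp φ)), h, add_neg_cancel]
  have h_fn (w : Space d) :
      cutFn Ω θ φ w • ∇ r w = Ω.indicator (fun w => (θ w * φ w) • ∇ r w) w := by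
    by_cases hw : w ∈ Ω <;> simp [cutFn, hw]
  have h_grad (w : Space d) : r w • cutGrad Ω θ φ G w =
      Ω.indicator (fun w => r w • (θ w • G w + φ w • ∇ θ w)) w := by
    by_cases hw : w ∈ Ω <;> simp [cutGrad, hw]
  rw [hρ.gradient_convolution ((hθ.memLp_cutFn hΩ φ).locallyIntegrable (by norm_num)),
    convolution_eq_swap, ← hr_def, eq_comm, ← add_eq_zero_iff_eq_neg, ← h_sum,
    ← integral_indicator hΩ, ← integral_indicator hΩ]
  simp only [h_fn, ← h_grad, ContinuousLinearMap.lsmul_apply, r]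

end IsTestFunction

theorem tsupport_convolution_cutFn_subset (hρ : HasCompactSupport ρ) (hθ : HasCompactSupport θ)
    (φ : L2 Ω) :
    tsupport (ρ ⋆[ContinuousLinearMap.lsmul ℝ ℝ] cutFn Ω θ φ) ⊆
      tsupport ρ + closure Ω ∩ tsupport θ := by
  have hclosed : IsClosed (tsupport ρ + closure Ω ∩ tsupport θ) :=
    (hρ.isCompact.add (hθ.isCompact.inter_left isClosed_closure)).isClosed
  refine closure_minimal ((support_convolution_subset _).trans ?_) hclosed
  refine add_subset_add (subset_tsupport ρ) fun x hx => ?_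
  have hxΩ : x ∈ Ω := mem_of_indicator_ne_zero hx
  refine ⟨subset_closure hxΩ, subset_tsupport θ fun h => hx ?_⟩
  rw [cutFn, indicator_of_mem hxΩ, h, zero_mul]

theorem mul_mem_closure_testGraph (hΩ : MeasurableSet Ω) (hθ : IsTestFunction univ θ)
    (φ : L2 Ω) (G : L2Vec Ω)
    (h : ∀ δ > 0, ∃ ρ : Space d → ℝ, IsTestFunction (Metric.ball 0 δ) ρ ∧ (∀ x, 0 ≤ ρ x) ∧
      ∫ x, ρ x = 1 ∧
      (∀ y ∈ Ω, ∫ x in Ω, φ x • ∇ (fun w => ρ (y - w) * θ w) x =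
        -∫ x in Ω, (ρ (y - x) * θ x) • G x) ∧
      tsupport ρ + closure Ω ∩ tsupport θ ⊆ Ω') :
    ((hθ.memLp_mul φ).toLp _, (hθ.memLp_smul_add φ G).toLp _) ∈
      (testGraph Ω' Ω).topologicalClosure := by
  refine mem_closure_testGraph fun ε hε => ?_
  obtain ⟨δ₁, hδ₁, hclose₁⟩ := exists_eLpNorm_convolution_sub_le (hθ.memLp_cutFn hΩ φ) hε
  obtain ⟨δ₂, hδ₂, hclose₂⟩ := exists_eLpNorm_convolution_sub_le (hθ.memLp_cutGrad hΩ φ G) hε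
  obtain ⟨ρ, hρ, hρ0, hρ1, htest, hsupp⟩ := h (min δ₁ δ₂) (lt_min hδ₁ hδ₂)
  have hρ_support : Function.support ρ ⊆ Metric.ball 0 (min δ₁ δ₂) :=
    (subset_tsupport ρ).trans hρ.tsupport_subset
  have htsupp := tsupport_convolution_cutFn_subset hρ.hasCompactSupport hθ.hasCompactSupport φ
  have hcompact : HasCompactSupport (ρ ⋆[ContinuousLinearMap.lsmul ℝ ℝ] cutFn Ω θ φ) :=
    (hρ.hasCompactSupport.isCompact.add (hθ.hasCompactSupport.isCompact.inter_left
      isClosed_closure)).of_isClosed_subset (isClosed_tsupport _) htsupp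
  refine ⟨ρ ⋆[ContinuousLinearMap.lsmul ℝ ℝ] cutFn Ω θ φ, ⟨?_, hcompact, htsupp.trans hsupp⟩,
    (eLpNorm_congr_ae ?_).trans_le <| (eLpNorm_mono_measure _ Measure.restrict_le_self).trans <|
      hclose₁ ρ hρ.continuous hρ0
        (hρ_support.trans (Metric.ball_subset_ball (min_le_left _ _))) hρ1,
    (eLpNorm_congr_ae ?_).trans_le <| (eLpNorm_mono_measure _ Measure.restrict_le_self).trans <|
      hclose₂ ρ hρ.continuous hρ0
        (hρ_support.trans (Metric.ball_subset_ball (min_le_right _ _))) hρ1⟩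
  · exact hρ.hasCompactSupport.contDiff_convolution_left _ hρ.smooth
      ((hθ.memLp_cutFn hΩ φ).locallyIntegrable (by norm_num))
  · filter_upwards [(hθ.memLp_mul φ).coeFn_toLp, ae_restrict_mem hΩ] with x hx hxΩ
    rw [hx, cutFn, indicator_of_mem hxΩ]
  · filter_upwards [(hθ.memLp_smul_add φ G).coeFn_toLp, ae_restrict_mem hΩ] with x hx hxΩ
    rw [hx, (hρ.mono (subset_univ _)).gradient_convolution_cutFn hθ hΩ φ G x (htest x hxΩ),
      cutGrad, indicator_of_mem hxΩ]

theorem exists_smooth_density_tsupport_eq (a : Space d) {R : ℝ} (hR : 0 < R) :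
    ∃ ρ : Space d → ℝ, ContDiff ℝ (⊤ : ℕ∞) ρ ∧ (∀ x, 0 ≤ ρ x) ∧ ∫ x, ρ x = 1 ∧
      tsupport ρ = Metric.closedBall a R := by
  let b : ContDiffBump a := ⟨R / 2, R, by positivity, by linarith⟩
  exact ⟨b.normed volume, b.contDiff_normed, b.nonneg_normed, b.integral_normed,
    b.tsupport_normed_eq⟩

theorem exists_smooth_density_in_ball (e : Space d) {c t₀ δ : ℝ} (hc : 0 < c) (ht₀ : 0 < t₀)
    (hδ : 0 < δ) :
    ∃ t : ℝ, 0 < t ∧ t < t₀ ∧ ∃ ρ : Space d → ℝ, IsTestFunction (Metric.ball 0 δ) ρ ∧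
      (∀ x, 0 ≤ ρ x) ∧ ∫ x, ρ x = 1 ∧ tsupport ρ = Metric.closedBall (t • e) (c * t) := by
  obtain ⟨t, ht, ht_lt⟩ := exists_between (lt_min ht₀ (show 0 < δ / (‖e‖ + c) by positivity))
  obtain ⟨ρ, hρ, hρ0, hρ1, hsupp⟩ := exists_smooth_density_tsupport_eq (t • e) (mul_pos hc ht)
  have htδ : t * (‖e‖ + c) < δ :=
    (lt_div_iff₀ (by positivity)).1 (ht_lt.trans_le (min_le_right _ _))
  refine ⟨t, ht, ht_lt.trans_le (min_le_left _ _), ρ, ⟨hρ, ?_, ?_⟩, hρ0, hρ1, hsupp⟩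
  · rw [HasCompactSupport, hsupp]
    exact isCompact_closedBall _ _
  · rw [hsupp]
    refine Metric.closedBall_subset_ball' ?_
    rw [dist_zero_right, norm_smul, Real.norm_of_nonneg ht.le]
    linarith

/- The mollifier is shifted upwards, so that near the boundary it only sees values below. -/
theorem mul_mem_closure_testGraph_univ (hΩ : IsOpen Ω) (hθ : IsTestFunction univ θ)
    {e : Space d} (hs : ShiftsInto Ω (tsupport θ) e) {p : L2 Ω × L2Vec Ω} (hp : p ∈ H1 Ω) :
    ((hθ.memLp_mul p.1).toLp _, (hθ.memLp_smul_add p.1 p.2).toLp _) ∈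
      (testGraph univ Ω).topologicalClosure := by
  obtain ⟨c, hc, t₀, ht₀, hs⟩ := hs
  refine mul_mem_closure_testGraph hΩ.measurableSet hθ p.1 p.2 fun δ hδ => ?_
  obtain ⟨t, ht, htt₀, ρ, hρ, hρ0, hρ1, hsupp⟩ := exists_smooth_density_in_ball e hc ht₀ hδ
  refine ⟨ρ, hρ, hρ0, hρ1, fun y hy => hp _ ?_, subset_univ _⟩
  have hκ := hθ.mul_left (hρ.reflect_translate y).smooth
  refine ⟨hκ.smooth, hκ.hasCompactSupport, ?_⟩
  have hclosed : IsClosed ({w | y - w ∈ tsupport ρ} ∩ tsupport θ) :=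
    ((isClosed_tsupport ρ).preimage (by fun_prop)).inter (isClosed_tsupport θ)
  refine (closure_minimal (fun w hw => ?_) hclosed).trans ?_
  · exact ⟨subset_tsupport ρ (left_ne_zero_of_mul hw), subset_tsupport θ (right_ne_zero_of_mul hw)⟩
  · rintro w ⟨hwρ, hwθ⟩
    rw [mem_ofPred_eq, hsupp, mem_closedBall_iff_norm, ← norm_neg] at hwρ
    have hw_eq : y - t • e + -(y - w - t • e) = w := by abel
    exact hw_eq ▸ hs t ht htt₀ y (subset_closure hy) _ hwρ (.inr (hw_eq.symm ▸ hwθ))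

/- The hypothesis says that the extension of `p` by zero has a weak gradient on `ℝ^d`; this time
the mollifier is shifted downwards, which moves the support into `Ω`. -/
theorem mul_mem_H10 (hΩ : MeasurableSet Ω) (hθ : IsTestFunction univ θ)
    {e : Space d} (hs : ShiftsInto Ω (tsupport θ) e) {p : L2 Ω × L2Vec Ω}
    (hp : ∀ κ, IsTestFunction univ κ → ∫ x in Ω, p.1 x • ∇ κ x = -∫ x in Ω, κ x • p.2 x) :
    ((hθ.memLp_mul p.1).toLp _, (hθ.memLp_smul_add p.1 p.2).toLp _) ∈ H10 Ω := by
  obtain ⟨c, hc, t₀, ht₀, hs⟩ := hs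
  refine mul_mem_closure_testGraph hΩ hθ p.1 p.2 fun δ hδ => ?_
  obtain ⟨t, ht, htt₀, ρ, hρ, hρ0, hρ1, hsupp⟩ := exists_smooth_density_in_ball (-e) hc ht₀ hδ
  refine ⟨ρ, hρ, hρ0, hρ1, fun y _ => hp _ (hθ.mul_left (hρ.reflect_translate y).smooth), ?_⟩
  rintro _ ⟨s, hsρ, w, hw, rfl⟩
  rw [hsupp, mem_closedBall_iff_norm] at hsρ
  have hw_eq : w - t • e + (s - t • -e) = s + w := by rw [smul_neg]; abel
  change s + w ∈ Ω
  exact hw_eq ▸ hs t ht htt₀ w hw.1 _ hsρ (.inl hw.2)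

section Partition

variable {ι : Type*} [Fintype ι] {θ : ι → Space d → ℝ}

theorem sum_gradient_eq_zero_of_eventually_const {x : Space d}
    (hθ : ∀ i, DifferentiableAt ℝ (θ i) x) {c : ℝ} (hsum : ∀ᶠ y in 𝓝 x, ∑ i, θ i y = c) :
    ∑ i, ∇ (θ i) x = 0 := by
  have h := Filter.EventuallyEq.fderiv_eq (𝕜 := ℝ) hsum
  rw [fderiv_fun_sum fun i _ => hθ i, fderiv_fun_const] at h
  simp only [gradient]
  rw [← map_sum, h, Pi.zero_apply, map_zero]

theorem sum_mul_toLp (hΩ : IsOpen Ω) (hθ : ∀ i, IsTestFunction univ (θ i))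
    (hsum : ∀ x ∈ Ω, ∑ i, θ i x = 1) (p : L2 Ω × L2Vec Ω) :
    ∑ i, (((hθ i).memLp_mul p.1).toLp _, ((hθ i).memLp_smul_add p.1 p.2).toLp _) = p := by
  have hgrad (x : Space d) (hx : x ∈ Ω) : ∑ i, ∇ (θ i) x = 0 :=
    sum_gradient_eq_zero_of_eventually_const (fun i => (hθ i).differentiable x)
      (Filter.mem_of_superset (hΩ.mem_nhds hx) hsum)
  refine Prod.ext ?_ ?_
  · rw [Prod.fst_sum]
    refine Lp.ext ?_
    filter_upwards [Lp.coeFn_finsetSum Finset.univ fun i => ((hθ i).memLp_mul p.1).toLp _,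
      ae_all_iff.2 fun i => ((hθ i).memLp_mul p.1).coeFn_toLp,
      ae_restrict_mem hΩ.measurableSet] with x hx hterm hxΩ
    rw [hx]
    simp only [Finset.sum_apply, hterm, ← Finset.sum_mul, hsum x hxΩ, one_mul]
  · rw [Prod.snd_sum]
    refine Lp.ext ?_
    filter_upwards [Lp.coeFn_finsetSum Finset.univ
      fun i => ((hθ i).memLp_smul_add p.1 p.2).toLp _,
      ae_all_iff.2 fun i => ((hθ i).memLp_smul_add p.1 p.2).coeFn_toLp,
      ae_restrict_mem hΩ.measurableSet] with x hx hterm hxΩ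
    rw [hx]
    simp only [Finset.sum_apply, hterm, Finset.sum_add_distrib, ← Finset.sum_smul,
      ← Finset.smul_sum, hsum x hxΩ, hgrad x hxΩ, one_smul, smul_zero, add_zero]

end Partition

theorem IsBoundedLipschitzDomain.mem_of_forall_mul_mem (hΩ : IsBoundedLipschitzDomain Ω)
    {S : Submodule ℝ (L2 Ω × L2Vec Ω)} {p : L2 Ω × L2Vec Ω}
    (h : ∀ (θ : Space d → ℝ) (hθ : IsTestFunction univ θ) (e : Space d),
      ShiftsInto Ω (tsupport θ) e →
        ((hθ.memLp_mul p.1).toLp _, (hθ.memLp_smul_add p.1 p.2).toLp _) ∈ S) : p ∈ S := by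
  obtain ⟨ι, _, θ, hθ, -, hsum, hcell⟩ := hΩ.exists_partition
  rw [← sum_mul_toLp hΩ.isOpen hθ (fun x hx => hsum x (subset_closure hx)) p]
  refine Submodule.sum_mem _ fun i _ => ?_
  obtain ⟨e, he⟩ := (hcell i).exists_shiftsInto hΩ.isOpen (hθ i).hasCompactSupport
  exact h _ (hθ i) e he

theorem H1_le_closure_testGraph_univ (hΩ : IsBoundedLipschitzDomain Ω) :
    H1 Ω ≤ (testGraph univ Ω).topologicalClosure := fun _ hp =>
  hΩ.mem_of_forall_mul_mem fun _ hθ _ he =>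
    mul_mem_closure_testGraph_univ hΩ.isOpen hθ he hp

theorem mem_H10_of_forall_integral (hΩ : IsBoundedLipschitzDomain Ω) {p : L2 Ω × L2Vec Ω}
    (hp : ∀ κ, IsTestFunction univ κ → ∫ x in Ω, p.1 x • ∇ κ x = -∫ x in Ω, κ x • p.2 x) :
    p ∈ H10 Ω :=
  hΩ.mem_of_forall_mul_mem fun _ hθ _ he => mul_mem_H10 hΩ.isOpen.measurableSet hθ he hp

end Density

section Graph

variable {E : Type*} [NormedAddCommGroup E] [InnerProductSpace ℝ E]

/-- The open subgraph of `h`, where `e` is the vertical direction. -/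
def subgraph (e : E) (h : (Submodule.span ℝ {e})ᗮ → ℝ) : Set E :=
  {y | inner ℝ e y < h ((Submodule.span ℝ {e})ᗮ.orthogonalProjectionOnto y)}

/-- The parametrisation of the graph of `h` by the hyperplane orthogonal to the vertical
direction `e`. -/
def graphMap (e : E) (h : (Submodule.span ℝ {e})ᗮ → ℝ) (z : (Submodule.span ℝ {e})ᗮ) : E :=
  z + h z • e

/-- The coordinates of the space in which `s` measures the height above the graph of `h`, so that
the subgraph becomes the half-space `s < 0`. -/
def graphChart (e : E) (h : (Submodule.span ℝ {e})ᗮ → ℝ) (p : (Submodule.span ℝ {e})ᗮ × ℝ) : E :=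
  graphMap e h p.1 + p.2 • e

variable {e : E} {h : (Submodule.span ℝ {e})ᗮ → ℝ} {K : NNReal}

theorem graphChart_eq_graphMap_add (e : E) (h : (Submodule.span ℝ {e})ᗮ → ℝ)
    (z : (Submodule.span ℝ {e})ᗮ) (s : ℝ) :
    graphChart e h (z, s) = graphMap e (fun z => h z + s) z := by
  simp only [graphChart, graphMap, add_smul, add_assoc]

theorem projection_graphMap (z : (Submodule.span ℝ {e})ᗮ) :
    (Submodule.span ℝ {e})ᗮ.orthogonalProjectionOnto (graphMap e h z) = z := by
  rw [graphMap, map_add, map_smul,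
    Submodule.orthogonalProjectionOnto_orthogonalComplement_singleton_eq_zero, smul_zero, add_zero,
    Submodule.orthogonalProjectionOnto_mem_subspace_eq_self]

theorem inner_graphMap (he : ‖e‖ = 1) (z : (Submodule.span ℝ {e})ᗮ) :
    inner ℝ e (graphMap e h z) = h z := by
  have hz : inner ℝ e (z : E) = 0 := Submodule.mem_orthogonal_singleton_iff_inner_right.1 z.2
  rw [graphMap, inner_add_right, hz, real_inner_smul_right, real_inner_self_eq_norm_sq, he]
  simp

theorem coe_projection_add_inner_smul (he : ‖e‖ = 1) (y : E) :
    ((Submodule.span ℝ {e})ᗮ.orthogonalProjectionOnto y : E) + inner ℝ e y • e = y := by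
  have h := (Submodule.span ℝ {e}).starProjection_add_starProjection_orthogonal y
  rw [Submodule.starProjection_unit_singleton ℝ he] at h
  rw [add_comm]
  exact h

theorem graphChart_mem_subgraph (he : ‖e‖ = 1) (p : (Submodule.span ℝ {e})ᗮ × ℝ) :
    graphChart e h p ∈ subgraph e h ↔ p.2 < 0 := by
  obtain ⟨z, s⟩ := p
  simp only [subgraph, mem_ofPred_eq, graphChart_eq_graphMap_add, inner_graphMap he,
    projection_graphMap, add_lt_iff_neg_left]

theorem mem_range_graphMap_iff (he : ‖e‖ = 1) {y : E} :
    y ∈ range (graphMap e h) ↔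
      inner ℝ e y = h ((Submodule.span ℝ {e})ᗮ.orthogonalProjectionOnto y) := by
  constructor
  · rintro ⟨z, rfl⟩
    rw [inner_graphMap he, projection_graphMap]
  · intro hy
    exact ⟨(Submodule.span ℝ {e})ᗮ.orthogonalProjectionOnto y, by
      rw [graphMap, ← hy, coe_projection_add_inner_smul he]⟩

theorem isOpen_subgraph (hh : Continuous h) : IsOpen (subgraph e h) :=
  isOpen_lt (by fun_prop) (hh.comp (by fun_prop))

theorem isClosedEmbedding_graphMap (hh : Continuous h) : IsClosedEmbedding (graphMap e h) :=
  Function.LeftInverse.isClosedEmbedding (f := (Submodule.span ℝ {e})ᗮ.orthogonalProjectionOnto)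
    projection_graphMap (by fun_prop) (by unfold graphMap; fun_prop)

theorem isClosedEmbedding_graphChart (he : ‖e‖ = 1) (hh : Continuous h) :
    IsClosedEmbedding (graphChart e h) := by
  refine Function.LeftInverse.isClosedEmbedding
    (f := fun y => ((Submodule.span ℝ {e})ᗮ.orthogonalProjectionOnto y,
      inner ℝ e y - h ((Submodule.span ℝ {e})ᗮ.orthogonalProjectionOnto y)))
    (fun ⟨z, s⟩ => ?_) (by fun_prop) (by unfold graphChart graphMap; fun_prop)
  simp only [graphChart_eq_graphMap_add, projection_graphMap, inner_graphMap he,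
    add_sub_cancel_left]

theorem lipschitzWith_graphMap (he : ‖e‖ = 1) (hh : LipschitzWith K h) :
    LipschitzWith (1 + K) (graphMap e h) := by
  refine LipschitzWith.of_dist_le_mul fun z w => ?_
  calc dist (graphMap e h z) (graphMap e h w)
      ≤ dist (z : E) w + dist (h z • e) (h w • e) := dist_add_add_le _ _ _ _
    _ = dist z w + dist (h z) (h w) := by
        rw [dist_eq_norm (h z • e), ← sub_smul, norm_smul, he, mul_one, ← dist_eq_norm,
          Subtype.dist_eq]
    _ ≤ dist z w + K * dist z w := by gcongr; exact hh.dist_le_mul z w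
    _ = ((1 + K : NNReal) : ℝ) * dist z w := by push_cast; ring

variable [FiniteDimensional ℝ E]

/-- The exterior normal of the subgraph of `h` at the point `graphMap e h z` of the graph. It is not
a unit vector: its length is the density of the surface measure with respect to `dz`. -/
noncomputable def graphNormal (e : E) (h : (Submodule.span ℝ {e})ᗮ → ℝ)
    (z : (Submodule.span ℝ {e})ᗮ) : E :=
  e - (∇ h z : (Submodule.span ℝ {e})ᗮ)

theorem graphNormal_add_const (s : ℝ) : graphNormal e (fun z => h z + s) = graphNormal e h := by
  ext z
  simp [graphNormal, gradient]

theorem inner_graphNormal (he : ‖e‖ = 1) (z : (Submodule.span ℝ {e})ᗮ) :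
    inner ℝ e (graphNormal e h z) = 1 := by
  rw [graphNormal, inner_sub_right, real_inner_self_eq_norm_sq, he,
    Submodule.mem_orthogonal_singleton_iff_inner_right.1 (∇ h z).2]
  norm_num

theorem norm_graphNormal_le (he : ‖e‖ = 1) (hh : LipschitzWith K h)
    (z : (Submodule.span ℝ {e})ᗮ) : ‖graphNormal e h z‖ ≤ 1 + K :=
  (norm_sub_le _ _).trans (add_le_add he.le (norm_gradient_le_of_lipschitzWith hh z))

theorem coe_gradient_comp_graphMap (he : ‖e‖ = 1) {w : E → ℝ} {z : (Submodule.span ℝ {e})ᗮ}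
    (hw : DifferentiableAt ℝ w (graphMap e h z)) (hh : DifferentiableAt ℝ h z) :
    (∇ (fun z => w (graphMap e h z)) z : (Submodule.span ℝ {e})ᗮ) =
      ∇ w (graphMap e h z) - inner ℝ e (∇ w (graphMap e h z)) • graphNormal e h z := by
  have hgraph : HasFDerivAt (graphMap e h)
      ((Submodule.span ℝ {e})ᗮ.subtypeL + (fderiv ℝ h z).smulRight e) z :=
    (Submodule.span ℝ {e})ᗮ.subtypeL.hasFDerivAt.add (hh.hasFDerivAt.smul_const e)
  have hcomp := hw.hasFDerivAt.comp z hgraph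
  refine ext_inner_right ℝ fun v => ?_
  set ξ := (Submodule.span ℝ {e})ᗮ.orthogonalProjectionOnto v with hξ
  have hv : (ξ : E) + inner ℝ e v • e = v := coe_projection_add_inner_smul he v
  have hcoe (a : (Submodule.span ℝ {e})ᗮ) : inner ℝ (a : E) v = inner ℝ a ξ := by
    rw [hξ, Submodule.inner_orthogonalProjectionOnto_eq_of_mem_left]
  have hwv : fderiv ℝ w (graphMap e h z) v =
      fderiv ℝ w (graphMap e h z) ξ + inner ℝ e v * fderiv ℝ w (graphMap e h z) e := by
    conv_lhs => rw [← hv]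
    rw [map_add, map_smul, smul_eq_mul]
  have hcomp' : fderiv ℝ (fun z => w (graphMap e h z)) z ξ =
      fderiv ℝ w (graphMap e h z) ξ + fderiv ℝ h z ξ * fderiv ℝ w (graphMap e h z) e := by
    rw [show (fun z => w (graphMap e h z)) = w ∘ graphMap e h from rfl, hcomp.fderiv]
    simp
  rw [hcoe, inner_gradient_left, hcomp', inner_sub_left, inner_gradient_left, hwv,
    real_inner_smul_left, graphNormal, inner_sub_left, hcoe, inner_gradient_left,
    inner_gradient_right, RCLike.conj_to_real]
  ring

theorem integral_Iio_inner_gradient (he : ‖e‖ = 1) {w : E → ℝ} (hw : ContDiff ℝ 1 w)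
    (hw' : HasCompactSupport w) (x : E) :
    ∫ s in Iio (0 : ℝ), inner ℝ e (∇ w (x + s • e)) = w x := by
  have hline (s : ℝ) : HasDerivAt (fun s : ℝ => x + s • e) e s := by
    simpa using ((hasDerivAt_id s).smul_const e).const_add x
  have hderiv (s : ℝ) : deriv (fun s : ℝ => w (x + s • e)) s = inner ℝ e (∇ w (x + s • e)) := by
    rw [inner_gradient_right, RCLike.conj_to_real]
    exact ((hw.differentiable one_ne_zero _).hasFDerivAt.comp_hasDerivAt s (hline s)).deriv
  have hemb : IsClosedEmbedding fun s : ℝ => x + s • e := by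
    refine Function.LeftInverse.isClosedEmbedding (f := fun y => inner ℝ e (y - x))
      (fun s => ?_) (by fun_prop) (by fun_prop)
    simp [real_inner_smul_right, he]
  have hftc := HasCompactSupport.integral_Iic_deriv_eq (f := fun s : ℝ => w (x + s • e))
    (hw.comp (by fun_prop)) (hw'.comp_isClosedEmbedding hemb) 0
  simpa only [integral_Iic_eq_integral_Iio, hderiv, zero_smul, add_zero] using hftc

variable [MeasurableSpace E] [BorelSpace E]

theorem measurable_graphNormal (e : E) (h : (Submodule.span ℝ {e})ᗮ → ℝ) :
    Measurable (graphNormal e h) :=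
  (measurable_gradient h).subtype_val.const_sub e

theorem integrable_smul_graphNormal (he : ‖e‖ = 1) (hh : LipschitzWith K h) {X : Type*}
    [MeasurableSpace X] {ν : Measure X} {f : X → ℝ} (hf : Integrable f ν)
    {π : X → (Submodule.span ℝ {e})ᗮ} (hπ : Measurable π) :
    Integrable (fun x => f x • graphNormal e h (π x)) ν :=
  hf.smul_bdd (1 + K) ((measurable_graphNormal e h).comp hπ).aestronglyMeasurable
    (.of_forall fun x => norm_graphNormal_le he hh (π x))

theorem measurePreserving_coe_add_smul (he : ‖e‖ = 1) :
    MeasurePreserving (fun p : (Submodule.span ℝ {e})ᗮ × ℝ => (p.1 : E) + p.2 • e)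
      (volume.prod volume) volume := by
  have hsum := ((Submodule.span ℝ {e}).measurePreserving_measurableEquivProd (0 : E)).symm
  rw [InnerProductSpace.euclideanHausdorffMeasure_eq_volume] at hsum
  have hline : MeasurePreserving (Prod.map (LinearIsometryEquiv.toSpanUnitSingleton (𝕜 := ℝ) e he)
      (id : (Submodule.span ℝ {e})ᗮ → (Submodule.span ℝ {e})ᗮ)) volume volume :=
    (LinearIsometryEquiv.toSpanUnitSingleton (𝕜 := ℝ) e he).measurePreserving.prod (.id volume)
  refine (hsum.comp (hline.comp Measure.measurePreserving_swap)).congr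
    (f' := fun p => (p.1 : E) + p.2 • e) (by fun_prop) (.of_forall fun p => ?_)
  simp [add_comm]

theorem measurePreserving_graphChart (he : ‖e‖ = 1) (hh : Measurable h) :
    MeasurePreserving (graphChart e h) := by
  have hshear : MeasurePreserving (fun p : (Submodule.span ℝ {e})ᗮ × ℝ => (p.1, h p.1 + p.2))
      volume volume :=
    (MeasurePreserving.id volume).skew_product (g := fun z s => h z + s) (by fun_prop)
      (.of_forall fun z => (measurePreserving_add_left volume (h z)).map_eq)
  refine ((measurePreserving_coe_add_smul he).comp hshear).congr (f' := graphChart e h)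
    (by unfold graphChart graphMap; fun_prop) (.of_forall fun p => ?_)
  simp only [graphChart, graphMap, Function.comp_apply, add_smul, add_assoc]

theorem setIntegral_subgraph (he : ‖e‖ = 1) (hh : Continuous h) {F : Type*}
    [NormedAddCommGroup F] [NormedSpace ℝ F] (f : E → F) :
    ∫ y in subgraph e h, f y =
      ∫ p, f (graphChart e h p) ∂(volume.prod (volume.restrict (Iio 0))) := by
  have hpre : graphChart e h ⁻¹' subgraph e h = univ ×ˢ Iio 0 := by
    ext p
    simp [graphChart_mem_subgraph he]
  rw [← (measurePreserving_graphChart he hh.measurable).setIntegral_preimage_emb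
    (isClosedEmbedding_graphChart he hh).measurableEmbedding, hpre, Measure.volume_eq_prod,
    ← Measure.prod_restrict, Measure.restrict_univ]

/- The gradient of `w` along the graph differs from the tangential gradient of `w ∘ graphMap`,
whose mean vanishes, by a multiple of the normal. -/
theorem integral_gradient_graphMap (he : ‖e‖ = 1) (hh : LipschitzWith K h) {w : E → ℝ}
    (hw : ContDiff ℝ 1 w) (hw' : HasCompactSupport w) :
    ∫ z, ∇ w (graphMap e h z) =
      ∫ z, inner ℝ e (∇ w (graphMap e h z)) • graphNormal e h z := by
  have hemb := isClosedEmbedding_graphMap (e := e) hh.continuous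
  obtain ⟨L, hL⟩ := hw.lipschitzWith_of_hasCompactSupport hw' one_ne_zero
  have hcomp : LipschitzWith (L * (1 + K)) fun z => w (graphMap e h z) :=
    hL.comp (lipschitzWith_graphMap he hh)
  have hcomp' : HasCompactSupport fun z => w (graphMap e h z) := hw'.comp_isClosedEmbedding hemb
  have htangential :
      ∫ z, ((∇ (fun z => w (graphMap e h z)) z : (Submodule.span ℝ {e})ᗮ) : E) = 0 := by
    have hint := integrable_gradient_of_lipschitzWith (μ := volume) hcomp hcomp'
    have h := (Submodule.span ℝ {e})ᗮ.subtypeL.integral_comp_comm hint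
    rwa [integral_gradient_eq_zero_of_lipschitzWith hcomp hcomp', map_zero] at h
  have hgrad : Integrable fun z => ∇ w (graphMap e h z) :=
    ((continuous_gradient hw).comp hemb.continuous).integrable_of_hasCompactSupport
      ((hasCompactSupport_gradient hw').comp_isClosedEmbedding hemb)
  have hnormal : Integrable fun z => inner ℝ e (∇ w (graphMap e h z)) • graphNormal e h z :=
    integrable_smul_graphNormal he hh (hgrad.const_inner e) measurable_id
  rw [← sub_eq_zero, ← integral_sub hgrad hnormal, ← htangential]
  refine integral_congr_ae ?_
  filter_upwards [hh.ae_differentiableAt] with z hz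
  rw [coe_gradient_comp_graphMap he (hw.differentiable one_ne_zero _) hz]

theorem setIntegral_subgraph_gradient (he : ‖e‖ = 1) (hh : LipschitzWith K h) {w : E → ℝ}
    (hw : ContDiff ℝ 1 w) (hw' : HasCompactSupport w) :
    ∫ y in subgraph e h, ∇ w y = ∫ z, w (graphMap e h z) • graphNormal e h z := by
  have hemb := isClosedEmbedding_graphChart he hh.continuous
  set ν : Measure ((Submodule.span ℝ {e})ᗮ × ℝ) := volume.prod (volume.restrict (Iio 0))
  have hgrad : Integrable (fun p => ∇ w (graphChart e h p)) ν :=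
    ((continuous_gradient hw).comp hemb.continuous).integrable_of_hasCompactSupport
      ((hasCompactSupport_gradient hw').comp_isClosedEmbedding hemb)
  have hnormal := integrable_smul_graphNormal he hh (hgrad.const_inner e) measurable_fst
  have hslice (s : ℝ) : ∫ z, ∇ w (graphChart e h (z, s)) =
      ∫ z, inner ℝ e (∇ w (graphChart e h (z, s))) • graphNormal e h z := by
    have hh' : LipschitzWith K fun z => h z + s := by simpa using hh.add (LipschitzWith.const s)
    simpa only [graphChart_eq_graphMap_add, graphNormal_add_const] using
      integral_gradient_graphMap he hh' hw hw'
  rw [setIntegral_subgraph he hh.continuous, integral_prod_symm _ hgrad]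
  simp only [hslice]
  rw [← integral_prod_symm _ hnormal, integral_prod _ hnormal]
  simp only [graphChart, integral_smul_const, integral_Iio_inner_gradient he hw hw']

theorem enorm_setIntegral_subgraph_gradient_le (he : ‖e‖ = 1) (hh : LipschitzWith K h) {w : E → ℝ}
    (hw : ContDiff ℝ 1 w) (hw' : HasCompactSupport w) :
    ‖∫ y in subgraph e h, ∇ w y‖ₑ ≤ (1 + K : NNReal) * ∫⁻ z, ‖w (graphMap e h z)‖ₑ := by
  rw [setIntegral_subgraph_gradient he hh hw hw', ← lintegral_const_mul' _ _ ENNReal.coe_ne_top]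
  refine (enorm_integral_le_lintegral_enorm _).trans (lintegral_mono fun z => ?_)
  rw [enorm_smul, mul_comm]
  gcongr
  exact enorm_le_coe.2 (norm_graphNormal_le he hh z)

theorem inner_setIntegral_subgraph_gradient (he : ‖e‖ = 1) (hh : LipschitzWith K h) {w : E → ℝ}
    (hw : ContDiff ℝ 1 w) (hw' : HasCompactSupport w) :
    inner ℝ e (∫ y in subgraph e h, ∇ w y) = ∫ z, w (graphMap e h z) := by
  have hint : Integrable fun z => w (graphMap e h z) • graphNormal e h z := by
    have hemb := isClosedEmbedding_graphMap (e := e) hh.continuous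
    exact integrable_smul_graphNormal he hh ((hw.continuous.comp
      hemb.continuous).integrable_of_hasCompactSupport (hw'.comp_isClosedEmbedding hemb))
      measurable_id
  rw [setIntegral_subgraph_gradient he hh hw hw', ← integral_inner hint]
  simp only [real_inner_smul_right, inner_graphNormal he, mul_one]

theorem euclideanHausdorffMeasure_image_le {X Y : Type*} [EMetricSpace X] [MeasurableSpace X]
    [BorelSpace X] [EMetricSpace Y] [MeasurableSpace Y] [BorelSpace Y] {L : NNReal} {f : X → Y}
    (hf : LipschitzWith L f) (n : ℕ) (s : Set X) :
    (Measure.euclideanHausdorffMeasure n : Measure Y) (f '' s) ≤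
      (L : ENNReal) ^ n * (Measure.euclideanHausdorffMeasure n : Measure X) s := by
  simp only [Measure.euclideanHausdorffMeasure_def, Measure.smul_apply, ENNReal.smul_def,
    smul_eq_mul]
  rw [mul_left_comm]
  gcongr
  simpa using hf.hausdorffMeasure_image_le (d := n) (by positivity) s

theorem euclideanHausdorffMeasure_orthogonal_singleton (he : e ≠ 0) :
    (Measure.euclideanHausdorffMeasure (Module.finrank ℝ E - 1) :
      Measure (Submodule.span ℝ {e})ᗮ) = volume := by
  have hsum := (Submodule.span ℝ {e}).finrank_add_finrank_orthogonal
  rw [finrank_span_singleton he] at hsum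
  rw [← hsum, Nat.add_sub_cancel_left, InnerProductSpace.euclideanHausdorffMeasure_eq_volume]

theorem map_graphMap_le (he : e ≠ 0) (hh : Continuous h) :
    volume.map (graphMap e h) ≤
      (Measure.euclideanHausdorffMeasure (Module.finrank ℝ E - 1)).restrict
        (range (graphMap e h)) := by
  have hproj : LipschitzWith 1 (Submodule.span ℝ {e})ᗮ.orthogonalProjectionOnto :=
    LipschitzWith.of_dist_le_mul fun y w => by
      rw [dist_eq_norm, dist_eq_norm, ← map_sub, NNReal.coe_one, one_mul]
      exact Submodule.norm_orthogonalProjectionOnto_apply_le _ _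
  refine Measure.le_iff.2 fun A hA => ?_
  rw [Measure.map_apply (isClosedEmbedding_graphMap hh).continuous.measurable hA,
    Measure.restrict_apply hA, ← euclideanHausdorffMeasure_orthogonal_singleton he]
  have hpre : graphMap e h ⁻¹' A =
      (Submodule.span ℝ {e})ᗮ.orthogonalProjectionOnto '' (A ∩ range (graphMap e h)) := by
    ext z
    constructor
    · exact fun hz => ⟨graphMap e h z, ⟨hz, z, rfl⟩, projection_graphMap z⟩
    · rintro ⟨_, ⟨hy, w, rfl⟩, rfl⟩
      rwa [projection_graphMap]
  rw [hpre]
  simpa using euclideanHausdorffMeasure_image_le hproj (Module.finrank ℝ E - 1)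
    (A ∩ range (graphMap e h))

theorem restrict_range_graphMap_le (he : ‖e‖ = 1) (hh : LipschitzWith K h) :
    (Measure.euclideanHausdorffMeasure (Module.finrank ℝ E - 1)).restrict (range (graphMap e h)) ≤
      ((1 + K : NNReal) : ENNReal) ^ (Module.finrank ℝ E - 1) • volume.map (graphMap e h) := by
  refine Measure.le_iff.2 fun A hA => ?_
  rw [Measure.smul_apply, Measure.map_apply (lipschitzWith_graphMap he hh).continuous.measurable hA,
    Measure.restrict_apply hA, ← euclideanHausdorffMeasure_orthogonal_singleton
      (norm_ne_zero_iff.1 (he.trans_ne one_ne_zero)), ← image_preimage_eq_inter_range]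
  exact euclideanHausdorffMeasure_image_le (lipschitzWith_graphMap he hh) _ _

end Graph

section Surface

variable {d : ℕ} {Ω B : Set (Space d)} {e : Space d} {K : NNReal}
  {h : (Submodule.span ℝ {e})ᗮ → ℝ} {w : Space d → ℝ}

theorem setIntegral_eq_of_inter_eq {α F : Type*} [MeasurableSpace α] [NormedAddCommGroup F]
    [NormedSpace ℝ F] {μ : Measure α} {S T B : Set α} (hS : MeasurableSet S)
    (hT : MeasurableSet T) (h : S ∩ B = T ∩ B) {f : α → F} (hf : ∀ x ∉ B, f x = 0) :
    ∫ x in S, f x ∂μ = ∫ x in T, f x ∂μ := by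
  rw [setIntegral_eq_of_subset_of_forall_sdiff_eq_zero hS inter_subset_left
      fun x hx => hf x fun hxB => hx.2 ⟨hx.1, hxB⟩, h,
    setIntegral_eq_of_subset_of_forall_sdiff_eq_zero hT inter_subset_left
      fun x hx => hf x fun hxB => hx.2 ⟨hx.1, hxB⟩]

theorem setLIntegral_eq_of_inter_eq {α : Type*} [MeasurableSpace α] {μ : Measure α}
    {S T B : Set α} (hB : MeasurableSet B) (h : S ∩ B = T ∩ B) {f : α → ENNReal}
    (hf : ∀ x ∉ B, f x = 0) : ∫⁻ x in S, f x ∂μ = ∫⁻ x in T, f x ∂μ := by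
  have hind : B.indicator f = f := by
    rw [indicator_eq_self]
    exact fun x hx => by_contra fun hxB => hx (hf x hxB)
  rw [← hind, setLIntegral_indicator hB, setLIntegral_indicator hB, inter_comm, h, inter_comm]

theorem notMem_of_mem_frontier_of_subset (hΩ : IsOpen Ω) {S : Set (Space d)} (hS : S ⊆ Ω)
    {x : Space d} (hx : x ∈ frontier Ω) : x ∉ S := fun hxS => by
  rw [hΩ.frontier_eq] at hx
  exact hx.2 (hS hxS)

theorem ae_surface_mem_frontier : ∀ᵐ x ∂surface Ω, x ∈ frontier Ω :=
  ae_restrict_mem isClosed_frontier.measurableSet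

theorem ae_surface_eq_zero (hΩ : IsOpen Ω) (hw : tsupport w ⊆ Ω) : w =ᵐ[surface Ω] 0 := by
  filter_upwards [ae_surface_mem_frontier] with x hx
  exact image_eq_zero_of_notMem_tsupport (notMem_of_mem_frontier_of_subset hΩ hw hx)

namespace IsSubgraphIn

theorem inter_eq (hg : IsSubgraphIn Ω B e K h) : Ω ∩ B = subgraph e h ∩ B := by
  ext y
  exact and_congr_left fun hy => hg.mem_iff y hy

theorem mem_closure_of_inner_eq (hg : IsSubgraphIn Ω B e K h) (hB : IsOpen B) {y : Space d}
    (hyB : y ∈ B)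
    (hy : inner ℝ e y = h ((Submodule.span ℝ {e})ᗮ.orthogonalProjectionOnto y)) :
    y ∈ closure Ω := by
  have hcont : Continuous fun t : ℝ => y - t • e := by fun_prop
  have hlim : Filter.Tendsto (fun t : ℝ => y - t • e) (𝓝[>] 0) (𝓝 y) := by
    simpa using (hcont.tendsto 0).mono_left (nhdsWithin_le_nhds (s := Ioi 0))
  refine mem_closure_of_tendsto hlim ?_
  filter_upwards [hlim.eventually (hB.mem_nhds hyB), self_mem_nhdsWithin] with t htB (ht : 0 < t)
  rw [hg.mem_iff _ htB, map_sub, map_smul,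
    Submodule.orthogonalProjectionOnto_orthogonalComplement_singleton_eq_zero, smul_zero, sub_zero,
    inner_sub_right, real_inner_smul_right, real_inner_self_eq_norm_sq, hg.norm_eq_one, hy]
  linarith

theorem frontier_inter_eq (hg : IsSubgraphIn Ω B e K h) (hB : IsOpen B) (hΩ : IsOpen Ω) :
    frontier Ω ∩ B = range (graphMap e h) ∩ B := by
  ext y
  refine and_congr_left fun hy => ?_
  rw [mem_range_graphMap_iff hg.norm_eq_one, hΩ.frontier_eq]
  constructor
  · rintro ⟨hy_closure, hyΩ⟩
    exact (hg.inner_le_of_mem_closure hB hy hy_closure).antisymm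
      (not_lt.1 fun hlt => hyΩ ((hg.mem_iff y hy).2 hlt))
  · exact fun heq =>
      ⟨hg.mem_closure_of_inner_eq hB hy heq, fun hyΩ => ((hg.mem_iff y hy).1 hyΩ).ne heq⟩

theorem lintegral_graphMap_le (hg : IsSubgraphIn Ω B e K h) (hB : IsOpen B) (hΩ : IsOpen Ω)
    {f : Space d → ENNReal} (hf : Measurable f) (hfB : ∀ x ∉ B, f x = 0) :
    ∫⁻ z, f (graphMap e h z) ≤ ∫⁻ x, f x ∂surface Ω := by
  have he : e ≠ 0 := norm_ne_zero_iff.1 (hg.norm_eq_one.trans_ne one_ne_zero)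
  have hle := map_graphMap_le he hg.lipschitzWith.continuous
  rw [finrank_euclideanSpace_fin] at hle
  rw [surface, setLIntegral_eq_of_inter_eq hB.measurableSet (hg.frontier_inter_eq hB hΩ) hfB,
    ← lintegral_map hf (isClosedEmbedding_graphMap hg.lipschitzWith.continuous).measurable]
  exact lintegral_mono' hle le_rfl

theorem lintegral_surface_le (hg : IsSubgraphIn Ω B e K h) (hB : IsOpen B) (hΩ : IsOpen Ω)
    {f : Space d → ENNReal} (hf : Measurable f) (hfB : ∀ x ∉ B, f x = 0) :
    ∫⁻ x, f x ∂surface Ω ≤ ((1 + K : NNReal) : ENNReal) ^ (d - 1) * ∫⁻ z, f (graphMap e h z) := by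
  have hle := restrict_range_graphMap_le hg.norm_eq_one hg.lipschitzWith
  rw [finrank_euclideanSpace_fin] at hle
  rw [surface, setLIntegral_eq_of_inter_eq hB.measurableSet (hg.frontier_inter_eq hB hΩ) hfB,
    ← lintegral_map hf (isClosedEmbedding_graphMap hg.lipschitzWith.continuous).measurable,
    ← smul_eq_mul, ← lintegral_smul_measure]
  exact lintegral_mono' hle le_rfl

theorem setIntegral_gradient_eq (hg : IsSubgraphIn Ω B e K h) (hΩ : IsOpen Ω)
    (hwB : tsupport w ⊆ B) : ∫ x in Ω, ∇ w x = ∫ x in subgraph e h, ∇ w x :=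
  setIntegral_eq_of_inter_eq hΩ.measurableSet
    (isOpen_subgraph hg.lipschitzWith.continuous).measurableSet hg.inter_eq
    fun _ hx => gradient_eq_zero_of_notMem_tsupport fun hxw => hx (hwB hxw)

theorem enorm_setIntegral_gradient_le (hg : IsSubgraphIn Ω B e K h) (hB : IsOpen B)
    (hΩ : IsOpen Ω) (hw : ContDiff ℝ 1 w) (hw' : HasCompactSupport w) (hwB : tsupport w ⊆ B) :
    ‖∫ x in Ω, ∇ w x‖ₑ ≤ (1 + K : NNReal) * ∫⁻ x, ‖w x‖ₑ ∂surface Ω := by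
  rw [hg.setIntegral_gradient_eq hΩ hwB]
  refine (enorm_setIntegral_subgraph_gradient_le hg.norm_eq_one hg.lipschitzWith hw hw').trans ?_
  gcongr
  refine hg.lintegral_graphMap_le hB hΩ hw.continuous.enorm.measurable fun x hx => ?_
  rw [image_eq_zero_of_notMem_tsupport fun hxw => hx (hwB hxw), enorm_zero]

theorem lintegral_surface_le_enorm_setIntegral_gradient (hg : IsSubgraphIn Ω B e K h)
    (hB : IsOpen B) (hΩ : IsOpen Ω) (hw : ContDiff ℝ 1 w) (hw' : HasCompactSupport w)
    (hw0 : ∀ x, 0 ≤ w x) (hwB : tsupport w ⊆ B) :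
    ∫⁻ x, ‖w x‖ₑ ∂surface Ω ≤
      ((1 + K : NNReal) : ENNReal) ^ (d - 1) * ‖∫ x in Ω, ∇ w x‖ₑ := by
  have hemb := isClosedEmbedding_graphMap (e := e) hg.lipschitzWith.continuous
  have hint : Integrable fun z => w (graphMap e h z) :=
    (hw.continuous.comp hemb.continuous).integrable_of_hasCompactSupport
      (hw'.comp_isClosedEmbedding hemb)
  have hvertical : ∫⁻ z, ‖w (graphMap e h z)‖ₑ ≤ ‖∫ x in Ω, ∇ w x‖ₑ := by
    calc ∫⁻ z, ‖w (graphMap e h z)‖ₑ = ‖∫ z, w (graphMap e h z)‖ₑ := by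
          rw [Real.enorm_of_nonneg (integral_nonneg fun _ => hw0 _),
            ofReal_integral_eq_lintegral_ofReal hint (.of_forall fun _ => hw0 _)]
          exact lintegral_congr fun z => Real.enorm_of_nonneg (hw0 _)
      _ = ‖inner ℝ e (∫ x in Ω, ∇ w x)‖ₑ := by
          rw [hg.setIntegral_gradient_eq hΩ hwB,
            inner_setIntegral_subgraph_gradient hg.norm_eq_one hg.lipschitzWith hw hw']
      _ ≤ ‖∫ x in Ω, ∇ w x‖ₑ := by
          rw [enorm_le_iff_norm_le]
          simpa [hg.norm_eq_one] using norm_inner_le_norm (𝕜 := ℝ) e (∫ x in Ω, ∇ w x)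
  refine (hg.lintegral_surface_le hB hΩ hw.continuous.enorm.measurable fun x hx => ?_).trans
    (by gcongr)
  rw [image_eq_zero_of_notMem_tsupport fun hxw => hx (hwB hxw), enorm_zero]

end IsSubgraphIn

namespace IsLipschitzCell

variable {S : Set (Space d)}

theorem exists_enorm_setIntegral_gradient_le (hS : IsLipschitzCell Ω S) (hΩ : IsOpen Ω) :
    ∃ C : NNReal, ∀ w : Space d → ℝ, ContDiff ℝ 1 w → HasCompactSupport w → tsupport w ⊆ S →
      ‖∫ x in Ω, ∇ w x‖ₑ ≤ C * ∫⁻ x, ‖w x‖ₑ ∂surface Ω := by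
  rcases hS with hS | ⟨x, r, e, K, h, hr, hS, hg⟩
  · refine ⟨0, fun w hw hw' hwS => ?_⟩
    obtain ⟨L, hL⟩ := hw.lipschitzWith_of_hasCompactSupport hw' one_ne_zero
    rw [setIntegral_eq_integral_of_forall_compl_eq_zero fun x hx =>
      gradient_eq_zero_of_notMem_tsupport fun hxw => hx (hS (hwS hxw)),
      integral_gradient_eq_zero_of_lipschitzWith hL hw', enorm_zero]
    exact zero_le
  · exact ⟨1 + K, fun w hw hw' hwS => hg.enorm_setIntegral_gradient_le Metric.isOpen_ball hΩ hw hw'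
      ((hwS.trans hS).trans (Metric.ball_subset_ball (by linarith)))⟩

theorem exists_lintegral_surface_le (hS : IsLipschitzCell Ω S) (hΩ : IsOpen Ω) :
    ∃ C : NNReal, ∀ w : Space d → ℝ, ContDiff ℝ 1 w → HasCompactSupport w → (∀ x, 0 ≤ w x) →
      tsupport w ⊆ S → ∫⁻ x, ‖w x‖ₑ ∂surface Ω ≤ C * ‖∫ x in Ω, ∇ w x‖ₑ := by
  rcases hS with hS | ⟨x, r, e, K, h, hr, hS, hg⟩
  · refine ⟨0, fun w _ _ _ hwS => ?_⟩
    rw [lintegral_congr_ae (g := 0) ((ae_surface_eq_zero hΩ (hwS.trans hS)).mono fun x hx => by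
      simp [hx])]
    simp
  · refine ⟨(1 + K) ^ (d - 1), fun w hw hw' hw0 hwS => ?_⟩
    rw [ENNReal.coe_pow]
    exact hg.lintegral_surface_le_enorm_setIntegral_gradient Metric.isOpen_ball hΩ hw hw' hw0
      ((hwS.trans hS).trans (Metric.ball_subset_ball (by linarith)))

end IsLipschitzCell

end Surface

section TraceInequality

theorem norm_gradient_mul_sq_le {E : Type*} [NormedAddCommGroup E] [InnerProductSpace ℝ E]
    [CompleteSpace E] {f g : E → ℝ} {x : E} (hf : DifferentiableAt ℝ f x)
    (hg : DifferentiableAt ℝ g x) :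
    ‖∇ (fun y => f y * g y ^ 2) x‖ ≤ (‖f x‖ + ‖∇ f x‖) * (‖g x‖ ^ 2 + ‖∇ g x‖ ^ 2) := by
  have hsq : ∇ (fun y => g y ^ 2) x = (2 * g x) • ∇ g x := by
    simp only [pow_two]
    rw [gradient_mul hg hg, ← add_smul, two_mul]
  rw [gradient_mul (g := fun y => g y ^ 2) hf (hg.pow 2), hsq]
  calc ‖f x • (2 * g x) • ∇ g x + g x ^ 2 • ∇ f x‖
      ≤ ‖f x‖ * (2 * ‖g x‖ * ‖∇ g x‖) + ‖∇ f x‖ * ‖g x‖ ^ 2 := by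
        refine (norm_add_le _ _).trans_eq ?_
        simp only [norm_smul, norm_mul, norm_pow, Real.norm_two]
        ring
    _ ≤ ‖f x‖ * (‖g x‖ ^ 2 + ‖∇ g x‖ ^ 2) + ‖∇ f x‖ * (‖g x‖ ^ 2 + ‖∇ g x‖ ^ 2) := by
        gcongr
        · exact two_mul_le_add_sq _ _
        · exact le_add_of_nonneg_right (sq_nonneg _)
    _ = (‖f x‖ + ‖∇ f x‖) * (‖g x‖ ^ 2 + ‖∇ g x‖ ^ 2) := by ring

theorem isClosed_map_of_norm_le {E F : Type*} [NormedAddCommGroup E] [NormedSpace ℝ E]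
    [CompleteSpace E] [NormedAddCommGroup F] [NormedSpace ℝ F] {T : Submodule ℝ E}
    (hT : IsClosed (T : Set E)) (f : E →L[ℝ] F) {C : NNReal} (h : ∀ x ∈ T, ‖x‖ ≤ C * ‖f x‖) :
    IsClosed (T.map (f : E →ₗ[ℝ] F) : Set F) := by
  have := hT.completeSpace_coe
  have hanti : AntilipschitzWith C (f.comp T.subtypeL) :=
    AddMonoidHomClass.antilipschitz_of_bound _ fun x => h x x.2
  have hrange : (T.map (f : E →ₗ[ℝ] F) : Set F) = range (f.comp T.subtypeL) := by
    rw [Submodule.map_coe, image_eq_range]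
    rfl
  rw [hrange]
  exact hanti.isClosed_range (f.comp T.subtypeL).uniformContinuous

variable {d : ℕ} {Ω : Set (Space d)}

/- Applying the divergence theorem to `θ η²` is what turns a bound by `∇` in `L¹` into a bound of
the trace in `L²`. -/
theorem exists_lintegral_surface_mul_sq_le (hΩ : IsOpen Ω) {θ : Space d → ℝ}
    (hθ : IsTestFunction univ θ) (hθ0 : ∀ x, 0 ≤ θ x) (hS : IsLipschitzCell Ω (tsupport θ)) :
    ∃ C : NNReal, ∀ η : Space d → ℝ, ContDiff ℝ 1 η →
      ∫⁻ x, ‖θ x * η x ^ 2‖ₑ ∂surface Ω ≤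
        C * ∫⁻ x in Ω, (‖η x‖ₑ ^ 2 + ‖∇ η x‖ₑ ^ 2) := by
  obtain ⟨C, hC⟩ := hS.exists_lintegral_surface_le hΩ
  obtain ⟨D, hD⟩ : BddAbove (range fun x => ‖θ x‖₊ + ‖∇ θ x‖₊) :=
    (hθ.continuous.nnnorm.add hθ.continuous_gradient.nnnorm).bddAbove_range_of_hasCompactSupport
      (HasCompactSupport.intro hθ.hasCompactSupport fun x hx => by
        simp [image_eq_zero_of_notMem_tsupport hx, gradient_eq_zero_of_notMem_tsupport hx])
  refine ⟨C * D, fun η hη => ?_⟩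
  have hpoint (x : Space d) :
      ‖∇ (fun y => θ y * η y ^ 2) x‖ₑ ≤ D * (‖η x‖ₑ ^ 2 + ‖∇ η x‖ₑ ^ 2) := by
    have h : ‖∇ (fun y => θ y * η y ^ 2) x‖₊ ≤
        (‖θ x‖₊ + ‖∇ θ x‖₊) * (‖η x‖₊ ^ 2 + ‖∇ η x‖₊ ^ 2) := by
      exact_mod_cast norm_gradient_mul_sq_le (hθ.differentiable x)
        (hη.differentiable one_ne_zero x)
    simp only [enorm_eq_nnnorm]
    exact_mod_cast h.trans (mul_le_mul_left (hD (mem_range_self x)) _)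
  calc ∫⁻ x, ‖θ x * η x ^ 2‖ₑ ∂surface Ω ≤ C * ‖∫ x in Ω, ∇ (fun y => θ y * η y ^ 2) x‖ₑ :=
        hC _ (hθ.contDiff_one.mul (hη.pow 2)) hθ.hasCompactSupport.mul_right
          (fun x => mul_nonneg (hθ0 x) (sq_nonneg _)) tsupport_mul_subset_left
    _ ≤ C * ∫⁻ x in Ω, ‖∇ (fun y => θ y * η y ^ 2) x‖ₑ := by
        gcongr
        exact enorm_integral_le_lintegral_enorm _
    _ ≤ C * ∫⁻ x in Ω, D * (‖η x‖ₑ ^ 2 + ‖∇ η x‖ₑ ^ 2) := by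
        gcongr with x
        exact hpoint x
    _ = ↑(C * D) * ∫⁻ x in Ω, (‖η x‖ₑ ^ 2 + ‖∇ η x‖ₑ ^ 2) := by
        rw [lintegral_const_mul' _ _ ENNReal.coe_ne_top, ENNReal.coe_mul, mul_assoc]

theorem IsBoundedLipschitzDomain.exists_lintegral_surface_sq_le
    (hΩ : IsBoundedLipschitzDomain Ω) :
    ∃ C : NNReal, ∀ η : Space d → ℝ, ContDiff ℝ 1 η →
      ∫⁻ x, ‖η x‖ₑ ^ 2 ∂surface Ω ≤ C * ∫⁻ x in Ω, (‖η x‖ₑ ^ 2 + ‖∇ η x‖ₑ ^ 2) := by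
  obtain ⟨ι, _, θ, hθ, hθ0, hsum, hcell⟩ := hΩ.exists_partition
  choose C hC using fun i =>
    exists_lintegral_surface_mul_sq_le hΩ.isOpen (hθ i) (hθ0 i) (hcell i)
  refine ⟨∑ i, C i, fun η hη => ?_⟩
  have hpoint : ∀ x ∈ frontier Ω, ‖η x‖ₑ ^ 2 = ∑ i, ‖θ i x * η x ^ 2‖ₑ := fun x hx => by
    simp only [enorm_mul, enorm_pow, Real.enorm_of_nonneg (hθ0 _ x)]
    rw [← Finset.sum_mul, ← ENNReal.ofReal_sum_of_nonneg fun i _ => hθ0 i x,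
      hsum x (frontier_subset_closure hx), ENNReal.ofReal_one, one_mul]
  calc ∫⁻ x, ‖η x‖ₑ ^ 2 ∂surface Ω = ∫⁻ x, ∑ i, ‖θ i x * η x ^ 2‖ₑ ∂surface Ω :=
        setLIntegral_congr_fun isClosed_frontier.measurableSet hpoint
    _ = ∑ i, ∫⁻ x, ‖θ i x * η x ^ 2‖ₑ ∂surface Ω :=
        lintegral_finsetSum _ fun i _ =>
          ((hθ i).continuous.mul (hη.continuous.pow 2)).enorm.measurable
    _ ≤ ∑ i, C i * ∫⁻ x in Ω, (‖η x‖ₑ ^ 2 + ‖∇ η x‖ₑ ^ 2) :=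
        Finset.sum_le_sum fun i _ => hC i η hη
    _ = ↑(∑ i, C i) * ∫⁻ x in Ω, (‖η x‖ₑ ^ 2 + ‖∇ η x‖ₑ ^ 2) := by
        rw [ENNReal.ofNNReal_finsetSum, Finset.sum_mul]

theorem IsBoundedLipschitzDomain.isFiniteMeasure_surface (hΩ : IsBoundedLipschitzDomain Ω) :
    IsFiniteMeasure (surface Ω) := by
  obtain ⟨C, hC⟩ := hΩ.exists_lintegral_surface_sq_le
  have h := hC (fun _ => 1) contDiff_const
  simp only [gradient_fun_const, enorm_one, one_pow, enorm_zero, ne_eq, OfNat.ofNat_ne_zero,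
    not_false_eq_true, zero_pow, add_zero, lintegral_one, Measure.restrict_apply_univ] at h
  exact ⟨h.trans_lt (ENNReal.mul_lt_top ENNReal.coe_lt_top hΩ.isBounded.measure_lt_top)⟩

theorem IsBoundedLipschitzDomain.exists_norm_le_of_mem_smoothTraceGraph
    (hΩ : IsBoundedLipschitzDomain Ω) :
    ∃ C : NNReal, ∀ p ∈ smoothTraceGraph Ω, ‖p.2.2‖ ≤ C * ‖(p.1, p.2.1)‖ := by
  obtain ⟨C, hC⟩ := hΩ.exists_lintegral_surface_sq_le
  refine ⟨NNReal.sqrt (C * 2), ?_⟩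
  rintro ⟨φ, G, f⟩ ⟨η, hη, hφ, hG, hf⟩
  have htrace : ‖f‖₊ ^ 2 ≤ C * (‖φ‖₊ ^ 2 + ‖G‖₊ ^ 2) := by
    have h := hC η (hη.of_le (by simp))
    rw [lintegral_add_left (hη.continuous.enorm.measurable.pow_const 2), ← eLpNorm_two_sq,
      ← eLpNorm_two_sq, ← eLpNorm_two_sq, ← eLpNorm_congr_ae hφ, ← eLpNorm_congr_ae hG,
      ← eLpNorm_congr_ae hf, ← Lp.enorm_def, ← Lp.enorm_def, ← Lp.enorm_def] at h
    simp only [enorm_eq_nnnorm] at h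
    exact_mod_cast h
  have hφG : ‖φ‖₊ ≤ ‖(φ, G)‖₊ := le_max_left _ _
  have hGφ : ‖G‖₊ ≤ ‖(φ, G)‖₊ := le_max_right _ _
  suffices ‖f‖₊ ≤ NNReal.sqrt (C * 2) * ‖(φ, G)‖₊ from NNReal.coe_le_coe.2 this
  rw [← pow_le_pow_iff_left₀ zero_le zero_le two_ne_zero, mul_pow, NNReal.sq_sqrt]
  calc ‖f‖₊ ^ 2 ≤ C * (‖φ‖₊ ^ 2 + ‖G‖₊ ^ 2) := htrace
    _ ≤ C * (‖(φ, G)‖₊ ^ 2 + ‖(φ, G)‖₊ ^ 2) := by gcongr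
    _ = C * 2 * ‖(φ, G)‖₊ ^ 2 := by ring

theorem IsBoundedLipschitzDomain.exists_norm_le_of_mem_closure_smoothTraceGraph
    (hΩ : IsBoundedLipschitzDomain Ω) :
    ∃ C : NNReal, ∀ p ∈ (smoothTraceGraph Ω).topologicalClosure, ‖p‖ ≤ C * ‖(p.1, p.2.1)‖ := by
  obtain ⟨C, hC⟩ := hΩ.exists_norm_le_of_mem_smoothTraceGraph
  have hclosed : IsClosed {p : L2 Ω × L2Vec Ω × L2Bdry Ω | ‖p.2.2‖ ≤ C * ‖(p.1, p.2.1)‖} :=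
    isClosed_le (by fun_prop) (by fun_prop)
  refine ⟨max 1 C, fun p hp => ?_⟩
  have hone : ‖(p.1, p.2.1)‖ ≤ ↑(max 1 C) * ‖(p.1, p.2.1)‖ :=
    le_mul_of_one_le_left (norm_nonneg _) (by simp)
  have htrace : ‖p.2.2‖ ≤ ↑(max 1 C) * ‖(p.1, p.2.1)‖ :=
    (show ‖p.2.2‖ ≤ C * ‖(p.1, p.2.1)‖ from closure_minimal hC hclosed hp).trans
      (mul_le_mul_of_nonneg_right (by simp) (norm_nonneg _))
  exact max_le ((le_max_left _ _).trans hone) (max_le ((le_max_right _ _).trans hone) htrace)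

theorem IsBoundedLipschitzDomain.exists_mem_smoothTraceGraph_of_mem_testGraph
    (hΩ : IsBoundedLipschitzDomain Ω) {q : L2 Ω × L2Vec Ω} (hq : q ∈ testGraph univ Ω) :
    ∃ f : L2Bdry Ω, (q.1, q.2, f) ∈ smoothTraceGraph Ω := by
  obtain ⟨η, hη, hq, hq'⟩ := hq
  have := hΩ.isFiniteMeasure_surface
  have hmem : MemLp η 2 (surface Ω) :=
    hη.continuous.memLp_of_hasCompactSupport hη.hasCompactSupport
  exact ⟨hmem.toLp η, η, hη.smooth, hq, hq', hmem.coeFn_toLp⟩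

/- By the trace inequality, forgetting the boundary values is injective with closed range on the
closed graph, and this range contains the restrictions of test functions, which are dense. -/
theorem exists_hasTrace (hΩ : IsBoundedLipschitzDomain Ω) (φ : H1 Ω) :
    ∃ f : L2Bdry Ω, HasTrace φ f := by
  obtain ⟨C, hC⟩ := hΩ.exists_norm_le_of_mem_closure_smoothTraceGraph
  let forget : (L2 Ω × L2Vec Ω × L2Bdry Ω) →L[ℝ] (L2 Ω × L2Vec Ω) :=
    (ContinuousLinearMap.id ℝ _).prodMap (ContinuousLinearMap.fst ℝ _ _)
  have hclosed := isClosed_map_of_norm_le (Submodule.isClosed_topologicalClosure _) forget hC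
  have hdense : testGraph univ Ω ≤
      (smoothTraceGraph Ω).topologicalClosure.map (forget : _ →ₗ[ℝ] _) := fun q hq => by
    obtain ⟨f, hf⟩ := hΩ.exists_mem_smoothTraceGraph_of_mem_testGraph hq
    exact ⟨(q.1, q.2, f), Submodule.le_topologicalClosure _ hf, rfl⟩
  obtain ⟨⟨ψ, G, f⟩, hf, hφ⟩ :=
    Submodule.topologicalClosure_minimal _ hdense hclosed (H1_le_closure_testGraph_univ hΩ φ.2)
  obtain ⟨rfl, rfl⟩ : ψ = fn φ ∧ G = grad φ := Prod.ext_iff.1 hφ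
  exact ⟨f, hf⟩

theorem HasTrace.unique (hΩ : IsBoundedLipschitzDomain Ω) {φ : H1 Ω} {f g : L2Bdry Ω}
    (hf : HasTrace φ f) (hg : HasTrace φ g) : f = g := by
  obtain ⟨C, hC⟩ := hΩ.exists_norm_le_of_mem_closure_smoothTraceGraph
  have h := hC _ (Submodule.sub_mem _ hf hg)
  simp only [Prod.mk_sub_mk, sub_self, Prod.mk_zero_zero, norm_zero, mul_zero,
    norm_le_zero_iff, Prod.mk_eq_zero, true_and] at h
  exact sub_eq_zero.1 h

end TraceInequality

section ZeroTrace

variable {d : ℕ} {Ω : Set (Space d)}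

theorem IsBoundedLipschitzDomain.exists_enorm_setIntegral_gradient_le
    (hΩ : IsBoundedLipschitzDomain Ω) :
    ∃ C : NNReal, ∀ w : Space d → ℝ, ContDiff ℝ 1 w →
      ‖∫ x in Ω, ∇ w x‖ₑ ≤ C * ∫⁻ x, ‖w x‖ₑ ∂surface Ω := by
  obtain ⟨ι, _, θ, hθ, hθ0, hsum, hcell⟩ := hΩ.exists_partition
  choose C hC using fun i => (hcell i).exists_enorm_setIntegral_gradient_le hΩ.isOpen
  refine ⟨∑ i, C i, fun w hw => ?_⟩
  have hθw (i : ι) : ContDiff ℝ 1 fun x => θ i x * w x := (hθ i).contDiff_one.mul hw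
  have hθw' (i : ι) : HasCompactSupport fun x => θ i x * w x := (hθ i).hasCompactSupport.mul_right
  have hint (i : ι) : Integrable fun x => ∇ (fun y => θ i y * w y) x :=
    (continuous_gradient (hθw i)).integrable_of_hasCompactSupport
      (hasCompactSupport_gradient (hθw' i))
  have hgrad : ∀ x ∈ Ω, ∇ w x = ∑ i, ∇ (fun y => θ i y * w y) x := fun x hx => by
    have hlocal : w =ᶠ[𝓝 x] fun y => ∑ i, θ i y * w y := by
      filter_upwards [hΩ.isOpen.mem_nhds hx] with y hy
      rw [← Finset.sum_mul, hsum y (subset_closure hy), one_mul]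
    rw [gradient, hlocal.fderiv_eq (𝕜 := ℝ),
      fderiv_fun_sum fun i _ => (hθw i).differentiable one_ne_zero x, map_sum]
    rfl
  have hle (i : ι) : ∫⁻ x, ‖θ i x * w x‖ₑ ∂surface Ω ≤ ∫⁻ x, ‖w x‖ₑ ∂surface Ω := by
    refine lintegral_mono_ae (ae_surface_mem_frontier.mono fun x hx => ?_)
    have hθ1 : θ i x ≤ 1 := hsum x (frontier_subset_closure hx) ▸
      Finset.single_le_sum (fun j _ => hθ0 j x) (Finset.mem_univ i)
    rw [enorm_mul, Real.enorm_of_nonneg (hθ0 i x)]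
    exact mul_le_of_le_one_left' (ENNReal.ofReal_le_one.2 hθ1)
  calc ‖∫ x in Ω, ∇ w x‖ₑ = ‖∑ i, ∫ x in Ω, ∇ (fun y => θ i y * w y) x‖ₑ := by
        rw [setIntegral_congr_fun hΩ.isOpen.measurableSet hgrad,
          integral_finsetSum _ fun i _ => (hint i).restrict]
    _ ≤ ∑ i, ‖∫ x in Ω, ∇ (fun y => θ i y * w y) x‖ₑ := enorm_sum_le _ _
    _ ≤ ∑ i, C i * ∫⁻ x, ‖w x‖ₑ ∂surface Ω := Finset.sum_le_sum fun i _ =>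
        (hC i _ (hθw i) (hθw' i) tsupport_mul_subset_left).trans (mul_le_mul_right (hle i) _)
    _ = ↑(∑ i, C i) * ∫⁻ x, ‖w x‖ₑ ∂surface Ω := by
        rw [ENNReal.ofNNReal_finsetSum, Finset.sum_mul]

theorem IsBoundedLipschitzDomain.exists_norm_setIntegral_smul_gradient_add_le
    (hΩ : IsBoundedLipschitzDomain Ω) {κ : Space d → ℝ} (hκ : IsTestFunction univ κ) :
    ∃ C : NNReal, ∀ p ∈ smoothTraceGraph Ω,
      ‖(∫ x in Ω, p.1 x • ∇ κ x) + ∫ x in Ω, κ x • p.2.1 x‖ ≤ C * ‖p.2.2‖ := by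
  obtain ⟨C, hC⟩ := hΩ.exists_enorm_setIntegral_gradient_le
  have := hΩ.isFiniteMeasure_surface
  have hκΓ : MemLp κ 2 (surface Ω) :=
    hκ.continuous.memLp_of_hasCompactSupport hκ.hasCompactSupport
  refine ⟨C * ‖hκΓ.toLp κ‖₊, ?_⟩
  rintro ⟨φ, G, f⟩ ⟨η, hη, hφ, hG, hf⟩
  have hη1 : ContDiff ℝ 1 η := hη.of_le (by simp)
  have hgreen : (∫ x in Ω, φ x • ∇ κ x) + ∫ x in Ω, κ x • G x =
      ∫ x in Ω, ∇ (fun y => η y * κ y) x := by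
    have hφκ : Integrable (fun x => φ x • ∇ κ x) (volume.restrict Ω) :=
      memLp_one_iff_integrable.1 ((hκ.memLp_gradient_restrict Ω 2).smul (Lp.memLp φ))
    have hκG : Integrable (fun x => κ x • G x) (volume.restrict Ω) :=
      memLp_one_iff_integrable.1 ((Lp.memLp G).smul (hκ.memLp_restrict Ω 2))
    rw [← integral_add hφκ hκG]
    refine integral_congr_ae ?_
    filter_upwards [hφ, hG] with x hφx hGx
    rw [hφx, hGx, gradient_mul (hη1.differentiable one_ne_zero x) (hκ.differentiable x)]
  have hholder : ∫⁻ x, ‖η x * κ x‖ₑ ∂surface Ω ≤ ‖f‖ₑ * ‖hκΓ.toLp κ‖ₑ := by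
    rw [Lp.enorm_def, Lp.enorm_toLp, eLpNorm_congr_ae hf, ← eLpNorm_one_eq_lintegral_enorm]
    exact eLpNorm_smul_le_mul_eLpNorm (p := 2) (q := 2) (r := 1) (φ := η) (f := κ)
      hκ.continuous.aestronglyMeasurable hη.continuous.aestronglyMeasurable
  have hbound := (hC _ (hη1.mul hκ.contDiff_one)).trans (mul_le_mul_right hholder _)
  rw [hgreen]
  simp only [enorm_eq_nnnorm] at hbound
  norm_cast at hbound
  exact_mod_cast hbound.trans_eq (by ring : _ = C * ‖hκΓ.toLp κ‖₊ * ‖f‖₊)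

theorem mem_H10_of_hasTrace_zero (hΩ : IsBoundedLipschitzDomain Ω) {φ : H1 Ω}
    (hφ : HasTrace φ 0) : φ.1 ∈ H10 Ω := by
  refine mem_H10_of_forall_integral hΩ fun κ hκ => ?_
  obtain ⟨C, hC⟩ := hΩ.exists_norm_setIntegral_smul_gradient_add_le hκ
  have hcont : Continuous fun p : L2 Ω × L2Vec Ω × L2Bdry Ω =>
      (∫ x in Ω, p.1 x • ∇ κ x) + ∫ x in Ω, κ x • p.2.1 x :=
    (hκ.continuous_setIntegral_smul_gradient.comp continuous_fst).add
      (hκ.continuous_setIntegral_smul.comp (continuous_fst.comp continuous_snd))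
  have hclosed : IsClosed {p : L2 Ω × L2Vec Ω × L2Bdry Ω |
      ‖(∫ x in Ω, p.1 x • ∇ κ x) + ∫ x in Ω, κ x • p.2.1 x‖ ≤ C * ‖p.2.2‖} :=
    isClosed_le hcont.norm (by fun_prop)
  have hbound := closure_minimal hC hclosed hφ
  change ‖(∫ x in Ω, φ.1.1 x • ∇ κ x) + ∫ x in Ω, κ x • φ.1.2 x‖ ≤ C * ‖(0 : L2Bdry Ω)‖ at hbound
  rw [norm_zero, mul_zero, norm_le_zero_iff] at hbound
  exact eq_neg_of_add_eq_zero_left hbound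

theorem hasTrace_zero_of_mem_H10 (hΩ : IsOpen Ω) {φ : H1 Ω} (hφ : φ.1 ∈ H10 Ω) :
    HasTrace φ 0 := by
  have hclosed : IsClosed {q : L2 Ω × L2Vec Ω |
      (q.1, q.2, (0 : L2Bdry Ω)) ∈ (smoothTraceGraph Ω).topologicalClosure} :=
    (Submodule.isClosed_topologicalClosure (smoothTraceGraph Ω)).preimage (by fun_prop)
  refine closure_minimal (fun q hq => ?_) hclosed hφ
  obtain ⟨η, hη, hq, hq'⟩ := hq
  exact Submodule.le_topologicalClosure _ ⟨η, hη.smooth, hq, hq',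
    (Lp.coeFn_zero ℝ 2 _).trans (ae_surface_eq_zero hΩ hη.tsupport_subset).symm⟩

end ZeroTrace

section Duality

variable {d : ℕ} {Ω : Set (Space d)}

theorem field_sub (σ τ : HDiv Ω) : field (σ - τ) = field σ - field τ := rfl

theorem div_sub (σ τ : HDiv Ω) : div (σ - τ) = div σ - div τ := rfl

theorem HDiv_ext {σ τ : HDiv Ω} (hfield : field σ = field τ) (hdiv : div σ = div τ) : σ = τ :=
  Subtype.ext (Prod.ext hfield hdiv)

theorem hasTrace_trace (hΩ : IsBoundedLipschitzDomain Ω) (φ : H1 Ω) : HasTrace φ (trace φ) := by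
  have h := exists_hasTrace hΩ φ
  rw [trace, dif_pos h]
  exact Classical.choose_spec h

theorem hasTrace_lift (ψ : HHalf Ω) : HasTrace (lift ψ) ψ :=
  Classical.choose_spec (mem_HHalf.1 ψ.2)

theorem HasTrace.sub {φ ψ : H1 Ω} {f g : L2Bdry Ω} (hφ : HasTrace φ f) (hψ : HasTrace ψ g) :
    HasTrace (φ - ψ) (f - g) :=
  (smoothTraceGraph Ω).topologicalClosure.sub_mem hφ hψ

theorem trace_eq_iff (hΩ : IsBoundedLipschitzDomain Ω) {φ : H1 Ω} {f : HHalf Ω} :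
    trace φ = f ↔ HasTrace φ f :=
  ⟨fun h => h ▸ hasTrace_trace hΩ φ, fun h => Subtype.ext ((hasTrace_trace hΩ φ).unique hΩ h)⟩

theorem trace_sub (hΩ : IsBoundedLipschitzDomain Ω) (φ ψ : H1 Ω) :
    trace (φ - ψ) = trace φ - trace ψ :=
  (trace_eq_iff hΩ).2 ((hasTrace_trace hΩ φ).sub (hasTrace_trace hΩ ψ))

theorem sub_mem_H10_iff_trace_eq (hΩ : IsBoundedLipschitzDomain Ω) {φ ψ : H1 Ω} :
    (φ - ψ).1 ∈ H10 Ω ↔ trace φ = trace ψ := by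
  rw [← sub_eq_zero, ← trace_sub hΩ, trace_eq_iff hΩ]
  exact ⟨hasTrace_zero_of_mem_H10 hΩ.isOpen, mem_H10_of_hasTrace_zero hΩ⟩

theorem trace_lift (hΩ : IsBoundedLipschitzDomain Ω) (f : HHalf Ω) : trace (lift f) = f :=
  (trace_eq_iff hΩ).2 (hasTrace_lift f)

theorem normalTrace_trace (hΩ : IsBoundedLipschitzDomain Ω) (w : H1 Ω) (σ : HDiv Ω) :
    normalTrace σ (trace w) = inner ℝ (grad w) (field σ) + inner ℝ (fn w) (div σ) := by
  have hmem := (sub_mem_H10_iff_trace_eq hΩ).2 (trace_lift hΩ (trace w))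
  have hgreen : inner ℝ (grad (lift (trace w)) - grad w) (field σ) +
      inner ℝ (fn (lift (trace w)) - fn w) (div σ) = 0 :=
    inner_add_inner_eq_zero_of_mem_H10 hmem σ.2
  rw [inner_sub_left, inner_sub_left] at hgreen
  rw [normalTrace]
  linarith

theorem IsHarmonic.inner_eq_zero {φ : H1 Ω} (hφ : IsHarmonic φ) {p : L2 Ω × L2Vec Ω}
    (hp : p ∈ H10 Ω) : inner ℝ p.2 (grad φ) = 0 := by
  simpa using inner_add_inner_eq_zero_of_mem_H10 hp hφ

theorem isHarmonic_of_forall_inner_eq_zero {φ : H1 Ω}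
    (h : ∀ p ∈ H10 Ω, inner ℝ p.2 (grad φ) = 0) : IsHarmonic φ := by
  refine isWeakDivergence_iff.2 fun η hη => ?_
  rw [inner_zero_right, add_zero]
  exact h _ (testGraph_le_H10 hη.toLp_mem_testGraph)

theorem IsHarmonic.sub {φ ψ : H1 Ω} (hφ : IsHarmonic φ) (hψ : IsHarmonic ψ) :
    IsHarmonic (φ - ψ) := by
  have h := (HDiv Ω).sub_mem (x := (grad φ, 0)) (y := (grad ψ, 0)) hφ hψ
  rwa [Prod.mk_sub_mk, sub_self] at h

theorem exists_norm_le_of_mem_H10 (hd : 0 < d) (hΩ : IsBoundedLipschitzDomain Ω) :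
    ∃ C : NNReal, ∀ p ∈ H10 Ω, ‖p‖ ≤ C * ‖p.2‖ := by
  obtain ⟨C, hC⟩ := exists_norm_fst_le_of_mem_H10 hd hΩ.isOpen.measurableSet hΩ.isBounded
  refine ⟨max C 1, fun p hp => max_le ((hC p hp).trans ?_) ?_⟩
  · exact mul_le_mul_of_nonneg_right (by simp) (norm_nonneg _)
  · exact le_mul_of_one_le_left (norm_nonneg _) (by simp)

theorem eq_zero_of_mem_H10_of_snd_eq_zero (hd : 0 < d) (hΩ : IsBoundedLipschitzDomain Ω)
    {p : L2 Ω × L2Vec Ω} (hp : p ∈ H10 Ω) (h : p.2 = 0) : p = 0 := by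
  obtain ⟨C, hC⟩ := exists_norm_le_of_mem_H10 hd hΩ
  have hle := hC p hp
  rwa [h, norm_zero, mul_zero, norm_le_zero_iff] at hle

theorem eq_of_trace_eq_of_grad_eq (hd : 0 < d) (hΩ : IsBoundedLipschitzDomain Ω) {φ ψ : H1 Ω}
    (htrace : trace φ = trace ψ) (hgrad : grad φ = grad ψ) : φ = ψ := by
  have hmem := (sub_mem_H10_iff_trace_eq hΩ).2 htrace
  exact sub_eq_zero.1 (Subtype.ext
    (eq_zero_of_mem_H10_of_snd_eq_zero hd hΩ hmem (sub_eq_zero.2 hgrad)))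

theorem IsHarmonic.eq_of_trace_eq (hd : 0 < d) (hΩ : IsBoundedLipschitzDomain Ω) {φ ψ : H1 Ω}
    (hφ : IsHarmonic φ) (hψ : IsHarmonic ψ) (h : trace φ = trace ψ) : φ = ψ := by
  have horth := (hφ.sub hψ).inner_eq_zero ((sub_mem_H10_iff_trace_eq hΩ).2 h)
  exact eq_of_trace_eq_of_grad_eq hd hΩ h (sub_eq_zero.1 (inner_self_eq_zero.1 horth))

theorem exists_mem_H10_inner_sub_eq_zero (hd : 0 < d) (hΩ : IsBoundedLipschitzDomain Ω)
    (G : L2Vec Ω) : ∃ p ∈ H10 Ω, ∀ q ∈ H10 Ω, inner ℝ q.2 (G - p.2) = 0 := by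
  obtain ⟨C, hC⟩ := exists_norm_le_of_mem_H10 hd hΩ
  have := (isClosed_map_of_norm_le isClosed_H10
    (ContinuousLinearMap.snd ℝ (L2 Ω) (L2Vec Ω)) hC).completeSpace_coe
  obtain ⟨_, ⟨p, hp, rfl⟩, z, hz, hG⟩ := ((H10 Ω).map
    (ContinuousLinearMap.snd ℝ (L2 Ω) (L2Vec Ω) : _ →ₗ[ℝ] L2Vec Ω)).exists_add_mem_mem_orthogonal G
  refine ⟨p, hp, fun q hq => ?_⟩
  have hz' : G - p.2 = z := sub_eq_of_eq_add' hG
  rw [hz']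
  exact (Submodule.mem_orthogonal _ _).1 hz q.2 ⟨q, hq, rfl⟩

theorem existsUnique_isDirichletSolution (hd : 0 < d) (hΩ : IsBoundedLipschitzDomain Ω)
    (g : HHalf Ω) : ∃! u : H1 Ω, IsDirichletSolution g u := by
  obtain ⟨p, hp, horth⟩ := exists_mem_H10_inner_sub_eq_zero hd hΩ (grad (lift g))
  let u : H1 Ω := lift g - ⟨p, H10_le_H1 hp⟩
  have hu : IsHarmonic u := isHarmonic_of_forall_inner_eq_zero horth
  have hug : trace u = g := by
    rw [← trace_lift hΩ g, eq_comm, ← sub_mem_H10_iff_trace_eq hΩ]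
    simpa [u, trace_lift hΩ] using hp
  exact ⟨u, ⟨hu, hug⟩, fun u' hu' => hu'.1.eq_of_trace_eq hd hΩ hu (hu'.2.trans hug.symm)⟩

/- If `ω` is orthogonal to all divergences, then `(0, ω)` is orthogonal to `H(div, Ω)`, which is
the orthogonal complement of the pairs `(∇η, η)` of test functions; hence `(ω, 0) ∈ H¹₀(Ω)`. -/
theorem eq_zero_of_forall_inner_div (hd : 0 < d) (hΩ : IsBoundedLipschitzDomain Ω) {ω : L2 Ω}
    (hω : ∀ σ : HDiv Ω, inner ℝ (div σ) ω = 0) : ω = 0 := by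
  let swap : (L2 Ω × L2Vec Ω) →ₗ[ℝ] WithLp 2 (L2Vec Ω × L2 Ω) :=
    (WithLp.linearEquiv 2 ℝ (L2Vec Ω × L2 Ω)).symm.toLinearMap ∘ₗ
      (LinearMap.snd ℝ _ _).prod (LinearMap.fst ℝ _ _)
  have hmem : WithLp.toLp 2 ((0 : L2Vec Ω), ω) ∈
      ((testGraph Ω Ω).map swap).topologicalClosure := by
    rw [← Submodule.orthogonal_orthogonal_eq_closure, Submodule.mem_orthogonal]
    intro σ hσ
    have hdiv : IsWeakDivergence Ω σ.fst σ.snd := by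
      refine isWeakDivergence_iff.2 fun η hη => ?_
      have h := (Submodule.mem_orthogonal _ _).1 hσ _ ⟨_, hη.toLp_mem_testGraph, rfl⟩
      simpa [swap, WithLp.prod_inner_apply] using h
    have h := hω ⟨(σ.fst, σ.snd), hdiv⟩
    rw [WithLp.prod_inner_apply]
    simpa [div] using h
  have hmaps : MapsTo (fun σ : WithLp 2 (L2Vec Ω × L2 Ω) => (σ.snd, σ.fst))
      ((testGraph Ω Ω).map swap) (testGraph Ω Ω) := by
    rintro _ ⟨q, hq, rfl⟩
    exact hq
  have hH10 : (ω, (0 : L2Vec Ω)) ∈ H10 Ω := map_mem_closure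
    (f := fun σ : WithLp 2 (L2Vec Ω × L2 Ω) => (σ.snd, σ.fst)) (by fun_prop) hmem hmaps
  exact congrArg Prod.fst (eq_zero_of_mem_H10_of_snd_eq_zero hd hΩ hH10 rfl)

/-- The gradient of a harmonic function as an element of `H(div, Ω)`, with weak divergence `0`:
the first component of the solution of the mixed problem. -/
noncomputable def IsHarmonic.gradHDiv {φ : H1 Ω} (hφ : IsHarmonic φ) : HDiv Ω := ⟨(grad φ, 0), hφ⟩

theorem IsHarmonic.isMixedSolution (hΩ : IsBoundedLipschitzDomain Ω) {w : H1 Ω}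
    (hw : IsHarmonic w) : IsMixedSolution (trace w) hw.gradHDiv (fn w) := by
  intro σ ψ
  refine ⟨?_, inner_zero_left _⟩
  rw [normalTrace_trace hΩ, real_inner_comm (fn w)]
  rfl

theorem IsMixedSolution.div_eq_zero {f : HHalf Ω} {τ : HDiv Ω} {ω : L2 Ω}
    (h : IsMixedSolution f τ ω) : div τ = 0 :=
  inner_self_eq_zero.1 (h 0 (div τ)).2

theorem IsMixedSolution.unique (hd : 0 < d) (hΩ : IsBoundedLipschitzDomain Ω) {f : HHalf Ω}
    {τ τ' : HDiv Ω} {ω ω' : L2 Ω} (h : IsMixedSolution f τ ω) (h' : IsMixedSolution f τ' ω') :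
    τ = τ' ∧ ω = ω' := by
  have hsub : ∀ σ : HDiv Ω, inner ℝ (field τ - field τ') (field σ) +
      inner ℝ (div σ) (ω - ω') = 0 := by
    intro σ
    rw [inner_sub_left, inner_sub_right]
    linarith [(h σ 0).1, (h' σ 0).1]
  have hfield : field τ = field τ' := by
    have hself := hsub (τ - τ')
    rw [field_sub, div_sub, h.div_eq_zero, h'.div_eq_zero, sub_self, inner_zero_left,
      add_zero] at hself
    exact sub_eq_zero.1 (inner_self_eq_zero.1 hself)
  refine ⟨HDiv_ext hfield (h.div_eq_zero.trans h'.div_eq_zero.symm), sub_eq_zero.1 ?_⟩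
  refine eq_zero_of_forall_inner_div hd hΩ fun σ => ?_
  simpa [hfield] using hsub σ

theorem minorant_trace (hΩ : IsBoundedLipschitzDomain Ω) (w : H1 Ω) {σ : HDiv Ω}
    (hσ : div σ = 0) :
    minorant (trace w) σ = ‖grad w‖ ^ 2 - ‖grad w - field σ‖ ^ 2 := by
  rw [minorant, normalTrace_trace hΩ, hσ, inner_zero_right, add_zero, norm_sub_sq_real]
  ring

theorem IsHarmonic.isUniqueMaximiser (hΩ : IsBoundedLipschitzDomain Ω) {w : H1 Ω}
    (hw : IsHarmonic w) :
    IsUniqueMaximiser (minorant (trace w)) {σ : HDiv Ω | div σ = 0} hw.gradHDiv := by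
  refine ⟨rfl, fun σ hσ hne => ?_⟩
  have hpos : 0 < ‖grad w - field σ‖ :=
    norm_sub_pos_iff.2 fun h => hne (HDiv_ext h.symm hσ)
  have hzero : grad w - field hw.gradHDiv = 0 := sub_self _
  rw [minorant_trace hΩ w hσ, minorant_trace hΩ w (σ := hw.gradHDiv) rfl, hzero, norm_zero]
  nlinarith

theorem IsHarmonic.majorant_eq (hΩ : IsBoundedLipschitzDomain Ω) {w w' : H1 Ω}
    (hw : IsHarmonic w) (h : trace w' = trace w) :
    majorant w' = majorant w + ‖grad w' - grad w‖ ^ 2 := by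
  have horth : inner ℝ (grad w' - grad w) (grad w) = 0 :=
    hw.inner_eq_zero ((sub_mem_H10_iff_trace_eq hΩ).2 h)
  rw [majorant, majorant, ← sub_add_cancel (grad w') (grad w), norm_add_sq_real, horth,
    sub_add_cancel]
  ring

theorem IsHarmonic.isUniqueMinimiser (hd : 0 < d) (hΩ : IsBoundedLipschitzDomain Ω) {w : H1 Ω}
    (hw : IsHarmonic w) : IsUniqueMinimiser majorant {w' : H1 Ω | trace w' = trace w} w := by
  refine ⟨rfl, fun w' hw' hne => ?_⟩
  have hpos : 0 < ‖grad w' - grad w‖ :=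
    norm_sub_pos_iff.2 fun h => hne (eq_of_trace_eq_of_grad_eq hd hΩ hw' h)
  rw [hw.majorant_eq hΩ hw']
  exact lt_add_of_pos_right _ (pow_pos hpos 2)

end Duality

end FunctionalBEM

theorem mainTheorem4_general {d : ℕ} (hd : 0 < d) (Ω : Set (FunctionalBEM.Space d))
    (hΩ : FunctionalBEM.IsBoundedLipschitzDomain Ω)
    (g : FunctionalBEM.HHalf Ω) (v : FunctionalBEM.H1 Ω) (hv : FunctionalBEM.IsHarmonic v) :
    (∃! u : FunctionalBEM.H1 Ω, FunctionalBEM.IsDirichletSolution g u) ∧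
    (∃! p : FunctionalBEM.HDiv Ω × FunctionalBEM.L2 Ω,
      FunctionalBEM.IsMixedSolution (g - FunctionalBEM.trace v) p.1 p.2) ∧
    ∀ (u : FunctionalBEM.H1 Ω) (τ : FunctionalBEM.HDiv Ω) (ω : FunctionalBEM.L2 Ω),
      FunctionalBEM.IsDirichletSolution g u →
      FunctionalBEM.IsMixedSolution (g - FunctionalBEM.trace v) τ ω →
        FunctionalBEM.field τ = FunctionalBEM.grad (u - v) ∧
        ω = FunctionalBEM.fn (u - v) ∧
        FunctionalBEM.IsUniqueMaximiser (FunctionalBEM.minorant (g - FunctionalBEM.trace v))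
          {σ : FunctionalBEM.HDiv Ω | FunctionalBEM.div σ = 0} τ ∧
        FunctionalBEM.IsUniqueMinimiser FunctionalBEM.majorant
          {w : FunctionalBEM.H1 Ω | FunctionalBEM.trace w = g - FunctionalBEM.trace v}
          (u - v) := by
  have htrace : ∀ {u : FunctionalBEM.H1 Ω}, FunctionalBEM.IsDirichletSolution g u →
      g - FunctionalBEM.trace v = FunctionalBEM.trace (u - v) := fun hu => by
    rw [FunctionalBEM.trace_sub hΩ, hu.2]
  have hdirichlet := FunctionalBEM.existsUnique_isDirichletSolution hd hΩ g
  refine ⟨hdirichlet, ?_, fun u τ ω hu hτ => ?_⟩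
  · obtain ⟨u, hu, -⟩ := hdirichlet
    have hw := hu.1.sub hv
    rw [htrace hu]
    refine ⟨(hw.gradHDiv, FunctionalBEM.fn (u - v)), hw.isMixedSolution hΩ, fun p hp => ?_⟩
    obtain ⟨hfield, hfn⟩ := hp.unique hd hΩ (hw.isMixedSolution hΩ)
    exact Prod.ext hfield hfn
  · have hw := hu.1.sub hv
    rw [htrace hu] at hτ ⊢
    obtain ⟨rfl, rfl⟩ := hτ.unique hd hΩ (hw.isMixedSolution hΩ)
    exact ⟨rfl, rfl, hw.isUniqueMaximiser hΩ, hw.isUniqueMinimiser hd hΩ⟩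

theorem mainTheorem4 {d : ℕ} (hd : 2 ≤ d) (Ω : Set (FunctionalBEM.Space d))
    (hΩ : FunctionalBEM.IsBoundedLipschitzDomain Ω)
    (g : FunctionalBEM.HHalf Ω) (v : FunctionalBEM.H1 Ω) (hv : FunctionalBEM.IsHarmonic v) :
    (∃! u : FunctionalBEM.H1 Ω, FunctionalBEM.IsDirichletSolution g u) ∧
    (∃! p : FunctionalBEM.HDiv Ω × FunctionalBEM.L2 Ω,
      FunctionalBEM.IsMixedSolution (g - FunctionalBEM.trace v) p.1 p.2) ∧
    ∀ (u : FunctionalBEM.H1 Ω) (τ : FunctionalBEM.HDiv Ω) (ω : FunctionalBEM.L2 Ω),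
      FunctionalBEM.IsDirichletSolution g u →
      FunctionalBEM.IsMixedSolution (g - FunctionalBEM.trace v) τ ω →
        FunctionalBEM.field τ = FunctionalBEM.grad (u - v) ∧
        ω = FunctionalBEM.fn (u - v) ∧
        FunctionalBEM.IsUniqueMaximiser (FunctionalBEM.minorant (g - FunctionalBEM.trace v))
          {σ : FunctionalBEM.HDiv Ω | FunctionalBEM.div σ = 0} τ ∧
        FunctionalBEM.IsUniqueMinimiser FunctionalBEM.majorant
          {w : FunctionalBEM.H1 Ω | FunctionalBEM.trace w = g - FunctionalBEM.trace v}
          (u - v) :=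
  mainTheorem4_general (by omega) Ω hΩ g v hv
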